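/- There is a unique positive real number $\lambda_0$ with $e^{-\lambda_0}=\lambda_0+\lambda_0^2/2$, and $0.4912<\lambda_0<0.4913$. Assume the Riemann Hypothesis. Then there are absolute constants $C$ and $T_0$ such that for all $T\ge T_0$, all $t\in[T,2T]$, all real $x$ with $2\le x\le T^2$ and all real $\lambda\ge\lambda_0$, $$ \log|\zeta(\tfrac12+it)|\;\le\;\operatorname{Re}\sum_{2\le n\le x}\frac{\Lambda(n)}{n^{\frac12+\frac{\lambda}{\log x}+it}\,\log n}\,\frac{\log(x/n)}{\log x}\;+\;\frac{1+\lambda}{2}\,\frac{\log T}{\log x}\;+\;\frac{C}{\log x}, $$ where $\Lambda$ is the von Mangoldt function and $\log 0$ is read as $-\infty$ when $\zeta(\tfrac12+it)=0$. -/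

import Mathlib

/-! Write s = σ + it, ξ for `riemannXi` and F(σ) = Re (ξ'/ξ)(s). Under RH, Hadamard's partial
fractions give F(σ) = (σ - 1/2) Σ_ρ m_ρ/|s - ρ|². Hence F ≥ 0 and F(σ)/(σ - 1/2) decreases in σ. A
Stirling-type bound gives Re (ζ'/ζ)(s) ≥ F(σ) - (1/2) log T for 1/2 < σ ≤ 2. Two inequalities carry
the proof.

Integrating from 1/2 to σ, with F(y) ≥ (y - 1/2) F(σ)/(σ - 1/2), gives log|ζ(1/2+it)| ≤ log|ζ(s)| +
(1/2)(σ - 1/2)(log T - F(σ)); this is `log_norm_riemannZeta_half_le`.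

Integrating the explicit formula for Σ Λ(n) n^{-s} log(x/n) from σ to ∞ gives, with P the Dirichlet
polynomial `logZetaPoly`, log|ζ(s)| ≤ Re P - Re (ζ'/ζ)(s)/log x + (F(σ)/(σ - 1/2) + 2)
x^{1/2-σ}/log² x; this is `log_norm_riemannZeta_le`.

Add the two at σ = 1/2 + λ/log x and bound -Re ζ'/ζ by (1/2) log T - F. The coefficient of F/log x
is e^{-λ}/λ - 1 - λ/2, which is nonpositive exactly when e^{-λ} ≤ λ + λ²/2; this defines λ₀. The
coefficient of log T/log x is (1 + λ)/2. If the point lies to the right of σ = 2, the bound at σ = 2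
is transported instead.

Partial fractions come from Borel-Carathéodory estimates, without counting zeros
(`hasSum_logDeriv_of_zeros_on_line`). The explicit formula comes from uniqueness of Laplace
transforms, without moving contours (`sum_mul_sub_log_eq_of_laplace`). -/

/-! ### The constant λ₀. -/

theorem exists_unique_exp_neg_eq_quadratic :
    ∃ lam₀ : ℝ,
      (0 < lam₀ ∧ Real.exp (-lam₀) = lam₀ + lam₀ ^ 2 / 2) ∧
      (∀ y : ℝ, 0 < y → Real.exp (-y) = y + y ^ 2 / 2 → y = lam₀) ∧
      (0.4912 < lam₀ ∧ lam₀ < 0.4913) ∧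
      (∀ y : ℝ, lam₀ ≤ y → Real.exp (-y) ≤ y + y ^ 2 / 2) := by
  have hmono : ∀ y z : ℝ, 0 < y → y < z →
      y + y ^ 2 / 2 - Real.exp (-y) < z + z ^ 2 / 2 - Real.exp (-z) := by
    intro y z hy hyz
    have : Real.exp (-z) < Real.exp (-y) := Real.exp_lt_exp.2 (by linarith)
    nlinarith
  -- Multiplying by the positive exponential turns the sign into a comparison with eight Taylor
  -- terms, decided over the rationals.
  have h1 : (0.4912 : ℝ) + 0.4912 ^ 2 / 2 - Real.exp (-0.4912) < 0 := by
    have := Real.quadratic_le_exp_of_nonneg (x := 0) le_rfl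
    have h := Real.exp_bound' (x := 0.4912) (by norm_num) (by norm_num) (n := 8) (by norm_num)
    rw [Real.exp_neg]
    have hp := Real.exp_pos (0.4912 : ℝ)
    rw [sub_neg, ← one_div, lt_div_iff₀ hp]
    refine lt_of_le_of_lt (mul_le_mul_of_nonneg_left h (by norm_num)) ?_
    norm_num [Finset.sum_range_succ, Nat.factorial]
  have h2 : 0 < (0.4913 : ℝ) + 0.4913 ^ 2 / 2 - Real.exp (-0.4913) := by
    have h := Real.sum_le_exp_of_nonneg (x := 0.4913) (by norm_num) 8
    rw [Real.exp_neg]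
    have hp := Real.exp_pos (0.4913 : ℝ)
    rw [sub_pos, ← one_div, div_lt_iff₀ hp]
    refine lt_of_lt_of_le ?_ (mul_le_mul_of_nonneg_left h (by norm_num))
    norm_num [Finset.sum_range_succ, Nat.factorial]
  have hc : ContinuousOn (fun y : ℝ => y + y ^ 2 / 2 - Real.exp (-y)) (Set.Icc 0.4912 0.4913) := by
    fun_prop
  obtain ⟨l, hl, h0⟩ := intermediate_value_Ioo (by norm_num) hc ⟨h1, h2⟩
  have hl0 : 0 < l := lt_trans (by norm_num) hl.1
  simp only at h0
  refine ⟨l, ⟨hl0, by linarith⟩, fun y hy hy' => ?_, hl, fun y hy => ?_⟩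
  · rcases lt_trichotomy y l with h | h | h
    · have := hmono y l hy h; linarith
    · exact h
    · have := hmono l y hl0 h; linarith
  · rcases hy.lt_or_eq with h | h
    · have := hmono l y hl0 h; linarith
    · subst h; linarith

/-! ### Entire functions: removing zeros and local partial fractions. -/

section Entire

open Complex Metric Set Filter Topology

/-- Dividing an entire function by the zero factor at one point. -/
theorem Differentiable.exists_eq_sub_pow_mul {f : ℂ → ℂ} (hf : Differentiable ℂ f) {ρ : ℂ}
    (h : analyticOrderAt f ρ ≠ ⊤) :
    ∃ g : ℂ → ℂ, Differentiable ℂ g ∧ g ρ ≠ 0 ∧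
      ∀ z, f z = (z - ρ) ^ analyticOrderNatAt f ρ * g z := by
  classical
  have hfa : AnalyticAt ℂ f ρ := hf.analyticAt ρ
  obtain ⟨g, hg, hg0, hfg⟩ :=
    (hfa.analyticOrderAt_eq_natCast (n := analyticOrderNatAt f ρ)).1
      (Nat.cast_analyticOrderNatAt h).symm
  set m := analyticOrderNatAt f ρ
  set G : ℂ → ℂ := fun z => if z = ρ then g ρ else f z / (z - ρ) ^ m
  have hGg : G =ᶠ[𝓝 ρ] g := by
    filter_upwards [hfg] with z hz
    by_cases hzρ : z = ρ
    · simp [G, hzρ]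
    · have : (z - ρ) ^ m ≠ 0 := pow_ne_zero _ (sub_ne_zero.2 hzρ)
      simp only [G, if_neg hzρ, hz, smul_eq_mul]
      field_simp
  refine ⟨G, fun z => ?_, by simpa [G] using hg0, fun z => ?_⟩
  · by_cases hzρ : z = ρ
    · subst hzρ
      exact hg.differentiableAt.congr_of_eventuallyEq hGg
    · have h1 : G =ᶠ[𝓝 z] fun z => f z / (z - ρ) ^ m := by
        filter_upwards [isOpen_ne.mem_nhds hzρ] with y hy
        simp [G, show y ≠ ρ from hy]
      refine DifferentiableAt.congr_of_eventuallyEq ?_ h1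
      exact (hf z).div (by fun_prop) (pow_ne_zero _ (sub_ne_zero.2 hzρ))
  · by_cases hzρ : z = ρ
    · subst hzρ
      simpa [G] using hfg.self_of_nhds
    · have : (z - ρ) ^ m ≠ 0 := pow_ne_zero _ (sub_ne_zero.2 hzρ)
      simp only [G, if_neg hzρ]
      field_simp

/-- Dividing an entire function by the zero factors at finitely many points. -/
theorem Differentiable.exists_eq_prod_sub_pow_mul {f : ℂ → ℂ} (hf : Differentiable ℂ f)
    (h : ∀ ρ, analyticOrderAt f ρ ≠ ⊤) (S : Finset ℂ) :
    ∃ g : ℂ → ℂ, Differentiable ℂ g ∧ (∀ ρ ∈ S, g ρ ≠ 0) ∧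
      ∀ z, f z = (∏ ρ ∈ S, (z - ρ) ^ analyticOrderNatAt f ρ) * g z := by
  classical
  induction S using Finset.induction_on with
  | empty => exact ⟨f, hf, by simp, by simp⟩
  | insert ρ S hρ ih =>
    obtain ⟨g, hg, hg0, hfg⟩ := ih
    set P : ℂ → ℂ := fun z => ∏ ρ ∈ S, (z - ρ) ^ analyticOrderNatAt f ρ
    have hP : Differentiable ℂ P := by
      intro z
      exact DifferentiableAt.fun_finsetProd fun i _ => by fun_prop
    have hPρ : P ρ ≠ 0 := Finset.prod_ne_zero_iff.2 fun i hi =>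
      pow_ne_zero _ (sub_ne_zero.2 fun h => hρ (h ▸ hi))
    have hfPg : f = P * g := funext hfg
    have hord : analyticOrderAt f ρ = analyticOrderAt g ρ := by
      rw [hfPg, analyticOrderAt_mul (hP.analyticAt ρ) (hg.analyticAt ρ),
        (hP.analyticAt ρ).analyticOrderAt_eq_zero.2 hPρ, zero_add]
    obtain ⟨g', hg', hg'0, hgg'⟩ := hg.exists_eq_sub_pow_mul (ρ := ρ) (hord ▸ h ρ)
    have hnat : analyticOrderNatAt g ρ = analyticOrderNatAt f ρ := by
      simp only [analyticOrderNatAt, hord]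
    refine ⟨g', hg', fun i hi => ?_, fun z => ?_⟩
    · rcases Finset.mem_insert.1 hi with rfl | hi
      · exact hg'0
      · have := hg0 i hi
        rw [hgg'] at this
        exact right_ne_zero_of_mul this
    · rw [hfg, hgg', hnat, Finset.prod_insert hρ]
      ring

/-- An entire function without zeros in a ball, with bounded logarithmic modulus growth, has
logarithmic derivative with small derivative. -/
theorem norm_deriv_logDeriv_le {g : ℂ → ℂ} (hg : Differentiable ℂ g) {R M : ℝ} (hR : 0 < R)
    (hM : 0 < M) (h0 : ∀ z ∈ ball (0 : ℂ) R, g z ≠ 0)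
    (hb : ∀ z ∈ ball (0 : ℂ) R, ‖g z‖ ≤ ‖g 0‖ * Real.exp M) {z : ℂ} (hz : ‖z‖ ≤ R / 4) :
    DifferentiableAt ℂ (logDeriv g) z ∧ ‖deriv (logDeriv g) z‖ ≤ 128 * M / R ^ 2 := by
  have hd : DifferentiableOn ℂ (logDeriv g) (ball 0 R) := by
    intro w hw
    refine DifferentiableAt.differentiableWithinAt ?_
    have : DifferentiableAt ℂ (deriv g) w := (hg.analyticAt w).deriv.differentiableAt
    exact this.div (hg w) (h0 w hw)
  -- A primitive of g'/g on the ball is a logarithm of g/g(0). The growth hypothesis bounds its real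
  -- part by M, as Borel-Carathéodory requires.
  obtain ⟨h, hh0, hh⟩ : ∃ h : ℂ → ℂ, h 0 = 0 ∧
      ∀ w ∈ ball (0 : ℂ) R, HasDerivAt h (logDeriv g w) w := by
    obtain ⟨h, h1, h2⟩ := hd.isExactOn_ball.with_val_at 0 0
    exact ⟨h, h1, h2⟩
  have hmem0 : (0 : ℂ) ∈ ball (0 : ℂ) R := mem_ball_self hR
  have hexp : ∀ w ∈ ball (0 : ℂ) R, g w = g 0 * exp (h w) := by
    have hconst : ∀ w ∈ ball (0 : ℂ) R, g w * exp (-h w) = g 0 * exp (-h 0) := by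
      intro w hw
      refine (convex_ball (0 : ℂ) R).is_const_of_fderivWithin_eq_zero (𝕜 := ℂ)
        (f := fun w => g w * exp (-h w)) ?_ ?_ hw hmem0
      · intro y hy
        exact ((hg y).mul (hh y hy).differentiableAt.neg.cexp).differentiableWithinAt
      · intro y hy
        rw [fderivWithin_of_isOpen isOpen_ball hy]
        have : HasDerivAt (fun w => g w * exp (-h w))
            (deriv g y * exp (-h y) + g y * (exp (-h y) * -logDeriv g y)) y :=
          (hg y).hasDerivAt.mul (hh y hy).neg.cexp
        have h3 : deriv g y * exp (-h y) + g y * (exp (-h y) * -logDeriv g y) = 0 := by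
          rw [logDeriv_apply]
          have := h0 y hy
          field_simp
          ring
        rw [h3] at this
        ext
        simpa using congrArg (fun L : ℂ →L[ℂ] ℂ => L 1) this.hasFDerivAt.fderiv
    intro w hw
    have := hconst w hw
    rw [hh0, neg_zero, exp_zero, mul_one] at this
    rw [← this, mul_assoc, ← exp_add]
    simp
  have hhd : DifferentiableOn ℂ h (ball 0 R) := fun w hw =>
    (hh w hw).differentiableAt.differentiableWithinAt
  have hre : MapsTo h (ball 0 R) {z | z.re ≤ M} := by
    intro w hw
    have h1 := hb w hw
    rw [hexp w hw, norm_mul, norm_exp] at h1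
    have := le_of_mul_le_mul_left h1 (norm_pos_iff.2 (h0 0 hmem0))
    exact Real.exp_le_exp.1 this
  have hbound : ∀ w, ‖w‖ ≤ R / 2 → ‖h w‖ ≤ 2 * M := by
    intro w hw
    have hwR : w ∈ ball (0 : ℂ) R := by rw [mem_ball_zero_iff]; linarith
    refine (borelCaratheodory_zero hM hhd hre hR hwR hh0).trans ?_
    rw [div_le_iff₀ (by linarith)]
    nlinarith
  have hzR : z ∈ ball (0 : ℂ) R := by rw [mem_ball_zero_iff]; linarith
  refine ⟨hd.differentiableAt (isOpen_ball.mem_nhds hzR), ?_⟩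
  -- Two Cauchy estimates of radius R/8 shrink R/2 to 3R/8 and then to R/4. Each costs 8/R, whence 2
  -- · 8 · 8 = 128.
  have hderiv1 : ∀ w, ‖w‖ ≤ 3 * R / 8 → ‖logDeriv g w‖ ≤ 2 * M / (R / 8) := by
    intro w hw
    have hsub : closedBall w (R / 8) ⊆ ball 0 R := by
      intro y hy
      rw [mem_closedBall, dist_eq_norm] at hy
      rw [mem_ball_zero_iff]
      have := norm_add_le (y - w) w
      rw [sub_add_cancel] at this
      linarith
    have hw' : w ∈ ball (0 : ℂ) R := by rw [mem_ball_zero_iff]; linarith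
    rw [← (hh w hw').deriv]
    refine norm_deriv_le_of_forall_mem_sphere_norm_le (by linarith) ?_ ?_
    · refine DifferentiableOn.diffContOnCl ?_
      exact hhd.mono (closure_ball_subset_closedBall.trans hsub)
    · intro y hy
      rw [mem_sphere, dist_eq_norm] at hy
      refine hbound y ?_
      have := norm_add_le (y - w) w
      rw [sub_add_cancel] at this
      linarith
  have : ‖deriv (logDeriv g) z‖ ≤ 2 * M / (R / 8) / (R / 8) := by
    refine norm_deriv_le_of_forall_mem_sphere_norm_le (by linarith) ?_ ?_
    · refine DifferentiableOn.diffContOnCl (hd.mono (closure_ball_subset_closedBall.trans ?_))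
      intro y hy
      rw [mem_closedBall, dist_eq_norm] at hy
      rw [mem_ball_zero_iff]
      have := norm_add_le (y - z) z
      rw [sub_add_cancel] at this
      linarith
    · intro y hy
      rw [mem_sphere, dist_eq_norm] at hy
      refine hderiv1 y ?_
      have := norm_add_le (y - z) z
      rw [sub_add_cancel] at this
      linarith
  refine this.trans (le_of_eq ?_)
  field_simp
  ring

theorem HasDerivAt.log_norm {u : ℝ → ℂ} {u' : ℂ} {r : ℝ} (hu : HasDerivAt u u' r)
    (h : u r ≠ 0) : HasDerivAt (fun r => Real.log ‖u r‖) (u' / u r).re r := by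
  have h1 := hu.norm_sq.log (by simpa using h)
  have h2 := h1.const_mul (1 / 2)
  have h3 : (fun r => Real.log ‖u r‖) = fun y => 1 / 2 * Real.log (‖u y‖ ^ 2) := by
    ext y
    rw [Real.log_pow]
    push_cast
    ring
  rw [h3]
  refine h2.congr_deriv ?_
  have h4 : ‖u r‖ ^ 2 ≠ 0 := by simpa using h
  rw [Complex.div_re, Complex.normSq_eq_norm_sq, Complex.inner]
  field_simp
  simp

/-- Take q = g'/g, where f = P g and P collects the zeros in |ρ| ≤ R. On |z| = 2R one has |z - ρ| ≥
R ≥ |ρ|, so |P(z)| ≥ |P(0)| and g inherits the growth bound of f by the maximum principle; thus q is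
nearly constant. The last clause pins down the constant: zeros on the critical line are equidistant
from 0 and 1, so |g(0)| = |g(1)|, and Rolle applied to log|g| makes Re q vanish somewhere between.
-/
theorem exists_logDeriv_eq_sum_add {f : ℂ → ℂ} (hf : Differentiable ℂ f)
    (hord : ∀ ρ, analyticOrderAt f ρ ≠ ⊤) {R M : ℝ} (hR : 4 ≤ R) (hM : 0 < M)
    (hb : ∀ z, ‖z‖ ≤ 2 * R → ‖f z‖ ≤ ‖f 0‖ * Real.exp M) {S : Finset ℂ}
    (hS : ∀ ρ, ρ ∈ S ↔ ‖ρ‖ ≤ R ∧ f ρ = 0) :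
    ∃ q : ℂ → ℂ,
      (∀ z, f z ≠ 0 → logDeriv f z = ∑ ρ ∈ S, (analyticOrderNatAt f ρ : ℂ) / (z - ρ) + q z) ∧
      (∀ z z', ‖z‖ ≤ R / 4 → ‖z'‖ ≤ R / 4 → ‖q z - q z'‖ ≤ 128 * M / R ^ 2 * ‖z - z'‖) ∧
      ((∀ ρ ∈ S, ρ.re = 1 / 2) → ‖f 1‖ = ‖f 0‖ → ∃ r ∈ Ioo (0 : ℝ) 1, (q r).re = 0) := by
  obtain ⟨g, hg, hgS, hfg⟩ := hf.exists_eq_prod_sub_pow_mul hord S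
  set P : ℂ → ℂ := fun z => ∏ ρ ∈ S, (z - ρ) ^ analyticOrderNatAt f ρ with hPdef
  have hPd : Differentiable ℂ P := fun z =>
    DifferentiableAt.fun_finsetProd fun i _ => by fun_prop
  have hg0 : ∀ z ∈ ball (0 : ℂ) R, g z ≠ 0 := by
    intro z hz h
    rw [mem_ball_zero_iff] at hz
    exact hgS z ((hS z).2 ⟨hz.le, by rw [hfg, h, mul_zero]⟩) h
  have hPnorm : ∀ z, ‖P z‖ = ∏ ρ ∈ S, ‖z - ρ‖ ^ analyticOrderNatAt f ρ := by
    intro z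
    simp only [hPdef, norm_prod, norm_pow]
  have hsphere : ∀ z ∈ frontier (ball (0 : ℂ) (2 * R)), ‖g z‖ ≤ ‖g 0‖ * Real.exp M := by
    intro z hz
    rw [frontier_ball _ (by linarith), mem_sphere_zero_iff_norm] at hz
    have h1 : ∀ ρ ∈ S, ‖(0 : ℂ) - ρ‖ ≤ ‖z - ρ‖ := by
      intro ρ hρ
      have h2 := ((hS ρ).1 hρ).1
      have h3 := norm_sub_norm_le z ρ
      rw [zero_sub, norm_neg]
      linarith
    have h2 : ‖P 0‖ ≤ ‖P z‖ := by
      rw [hPnorm, hPnorm]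
      exact Finset.prod_le_prod (fun _ _ => by positivity)
        fun ρ hρ => pow_le_pow_left₀ (norm_nonneg _) (h1 ρ hρ) _
    have h3 : 0 < ‖P z‖ := by
      rw [hPnorm]
      refine Finset.prod_pos fun ρ hρ => pow_pos ?_ _
      have h2 := ((hS ρ).1 hρ).1
      have h3 := norm_sub_norm_le z ρ
      linarith
    have h4 := hb z hz.le
    rw [hfg z, hfg 0, norm_mul, norm_mul] at h4
    refine le_of_mul_le_mul_left (h4.trans ?_) h3
    rw [mul_assoc]
    exact mul_le_mul_of_nonneg_right h2 (by positivity)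
  have hbd : ∀ z ∈ ball (0 : ℂ) R, ‖g z‖ ≤ ‖g 0‖ * Real.exp M := by
    intro z hz
    refine norm_le_of_forall_mem_frontier_norm_le isBounded_ball hg.diffContOnCl hsphere ?_
    refine subset_closure ?_
    rw [mem_ball_zero_iff] at hz ⊢
    linarith
  have hmain := fun z (hz : ‖z‖ ≤ R / 4) =>
    norm_deriv_logDeriv_le hg (by linarith) hM hg0 hbd hz
  refine ⟨logDeriv g, fun z hz => ?_, fun z z' hz hz' => ?_, fun hre hf1 => ?_⟩
  · have hne : P z * g z ≠ 0 := by rw [← hfg]; exact hz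
    have hP0 := left_ne_zero_of_mul hne
    have : f = fun z => P z * g z := funext hfg
    rw [this, logDeriv_mul z hP0 (right_ne_zero_of_mul hne) (hPd z) (hg z), ← this]
    congr 1
    rw [hPdef, logDeriv_prod]
    · refine Finset.sum_congr rfl fun ρ hρ => ?_
      rw [logDeriv_fun_pow (by fun_prop)]
      rw [logDeriv_apply]
      simp [div_eq_mul_inv]
    · exact fun ρ hρ => Finset.prod_ne_zero_iff.1 hP0 ρ hρ
    · intro ρ hρ
      fun_prop
  · refine (convex_closedBall (0 : ℂ) (R / 4)).norm_image_sub_le_of_norm_deriv_le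
      (f := logDeriv g) (fun w hw => (hmain w (by simpa using hw)).1)
      (fun w hw => (hmain w (by simpa using hw)).2) ?_ ?_
    all_goals simpa
  · have h1 : ∀ ρ ∈ S, ‖(1 : ℂ) - ρ‖ = ‖(0 : ℂ) - ρ‖ := by
      intro ρ hρ
      have := hre ρ hρ
      rw [← sq_eq_sq₀ (norm_nonneg _) (norm_nonneg _), Complex.sq_norm, Complex.sq_norm,
        normSq_apply, normSq_apply]
      simp [this]
      norm_num
    have h2 : ‖P 1‖ = ‖P 0‖ := by
      rw [hPnorm, hPnorm]
      exact Finset.prod_congr rfl fun ρ hρ => by rw [h1 ρ hρ]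
    have hP0 : ‖P 0‖ ≠ 0 := by
      rw [hPnorm]
      refine Finset.prod_ne_zero_iff.2 fun ρ hρ => pow_ne_zero _ ?_
      have := hre ρ hρ
      rw [zero_sub, norm_neg, norm_ne_zero_iff]
      rintro rfl
      norm_num at this
    have h3 : ‖g 1‖ = ‖g 0‖ := by
      rw [hfg 1, hfg 0, norm_mul, norm_mul, h2] at hf1
      exact mul_left_cancel₀ hP0 hf1
    have hder : ∀ r ∈ Icc (0 : ℝ) 1,
        HasDerivAt (fun r : ℝ => Real.log ‖g r‖) (logDeriv g r).re r := by
      intro r hr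
      refine HasDerivAt.log_norm ((hg r).hasDerivAt.comp_ofReal) (hg0 _ ?_)
      rw [mem_ball_zero_iff, norm_real, Real.norm_eq_abs, abs_of_nonneg hr.1]
      linarith [hr.2]
    obtain ⟨r, hr, h⟩ := exists_hasDerivAt_eq_zero (f := fun r : ℝ => Real.log ‖g r‖)
      (f' := fun r : ℝ => (logDeriv g r).re) zero_lt_one
      (fun r hr => (hder r hr).continuousAt.continuousWithinAt) (by simp [h3])
      (fun r hr => hder r (Ioo_subset_Icc_self hr))
    exact ⟨r, hr, h⟩

end Entire

/-! ### Hadamard partial fractions for zeros on the critical line. -/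

section Hadamard

open Complex Metric Set Filter Topology

theorem tendsto_sum_of_exhaust {ι E : Type*} [NormedAddCommGroup E] [CompleteSpace E]
    {g : ι → E} {S : ℕ → Finset ι} (hS : ∀ i, g i ≠ 0 → ∀ᶠ n in atTop, i ∈ S n)
    (hg : Summable fun i => ‖g i‖) :
    Tendsto (fun n => ∑ i ∈ S n, g i) atTop (𝓝 (∑' i, g i)) := by
  classical
  have hind : ∀ n, ∑ i ∈ S n, g i = ∑' i, (S n : Set ι).indicator g i := fun n =>
    sum_eq_tsum_indicator g (S n)
  simp only [hind]
  refine tendsto_tsum_of_dominated_convergence hg (fun i => ?_) (Eventually.of_forall fun n i => ?_)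
  · refine tendsto_const_nhds.congr' ?_
    by_cases h : g i = 0
    · refine Eventually.of_forall fun n => ?_
      by_cases hi : i ∈ (S n : Set ι) <;> simp [Set.indicator, h]
    · filter_upwards [hS i h] with n hn
      simp [Set.indicator, hn]
  · exact norm_indicator_le_norm_self _ _

/-- Nonnegative finite sums are bounded by the limit along the exhaustion. Convergence over growing
discs of zeros thus becomes unconditional, with no prior estimate on the number of zeros. -/
theorem hasSum_of_exhaust_of_nonneg {ι : Type*} {g : ι → ℝ} {S : ℕ → Finset ι} {l : ℝ}
    (hS : ∀ i, g i ≠ 0 → ∀ᶠ n in atTop, i ∈ S n) (hg : ∀ i, 0 ≤ g i)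
    (hl : Tendsto (fun n => ∑ i ∈ S n, g i) atTop (𝓝 l)) : HasSum g l := by
  classical
  have hs : Summable g := by
    refine summable_of_sum_le hg (c := l) fun u => ?_
    refine ge_of_tendsto hl ?_
    have : ∀ᶠ n in atTop, ∀ i ∈ u, g i ≠ 0 → i ∈ S n := by
      rw [Filter.eventually_all_finset]
      intro i _
      by_cases h : g i = 0
      · simp [h]
      · filter_upwards [hS i h] with n hn _ using hn
    filter_upwards [this] with n hn
    rw [← Finset.sum_filter_ne_zero]
    refine Finset.sum_le_sum_of_subset_of_nonneg (fun i hi => ?_) fun i _ _ => hg i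
    rw [Finset.mem_filter] at hi
    exact hn i hi.1 hi.2
  have h2 := tendsto_sum_of_exhaust hS (by simpa using hs.norm)
  rw [tendsto_nhds_unique hl h2]
  exact hs.hasSum

theorem finite_closedBall_inter_zeros {f : ℂ → ℂ} (hf : Differentiable ℂ f) (h0 : f 0 ≠ 0)
    (R : ℝ) : {ρ : ℂ | ‖ρ‖ ≤ R ∧ f ρ = 0}.Finite := by
  have hfa : AnalyticOnNhd ℂ f univ := fun z _ => hf.analyticAt z
  have h := hfa.preimage_zero_mem_codiscrete (x := 0) h0
  rw [mem_codiscrete', ← preimage_compl, compl_compl] at h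
  have hc : IsClosed (f ⁻¹' {0}) := isClosed_singleton.preimage hf.continuous
  have := ((isCompact_closedBall (0 : ℂ) R).inter_right hc).finite
    (h.2.mono Set.inter_subset_right)
  refine this.subset fun ρ hρ => ⟨by simpa using hρ.1, hρ.2⟩

theorem analyticOrderAt_ne_top_of_differentiable {f : ℂ → ℂ} (hf : Differentiable ℂ f)
    (h0 : f 0 ≠ 0) (ρ : ℂ) : analyticOrderAt f ρ ≠ ⊤ := by
  have hfa : AnalyticOnNhd ℂ f univ := fun z _ => hf.analyticAt z
  refine hfa.analyticOrderAt_ne_top_of_isPreconnected isPreconnected_univ (x := 0) trivial trivial ?_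
  rw [(hf.analyticAt 0).analyticOrderAt_eq_zero.2 h0]
  simp

/-- 1/(ab) ≤ 1/a² + 1/b². This dominates differences of partial fractions by the square sums, whose
convergence is established first. -/
theorem norm_div_sub_div_le {s s' ρ m : ℂ} (hs : s ≠ ρ) (hs' : s' ≠ ρ) :
    ‖m / (s - ρ) - m / (s' - ρ)‖ ≤
      ‖s' - s‖ * (‖m‖ / ‖s - ρ‖ ^ 2 + ‖m‖ / ‖s' - ρ‖ ^ 2) := by
  have h1 : s - ρ ≠ 0 := sub_ne_zero.2 hs
  have h2 : s' - ρ ≠ 0 := sub_ne_zero.2 hs'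
  have : m / (s - ρ) - m / (s' - ρ) = m * (s' - s) / ((s - ρ) * (s' - ρ)) := by
    field_simp
    ring
  rw [this, norm_div, norm_mul, norm_mul]
  have h3 : 0 < ‖s - ρ‖ := norm_pos_iff.2 h1
  have h4 : 0 < ‖s' - ρ‖ := norm_pos_iff.2 h2
  have h5 : 1 / (‖s - ρ‖ * ‖s' - ρ‖) ≤ 1 / ‖s - ρ‖ ^ 2 + 1 / ‖s' - ρ‖ ^ 2 := by
    have h6 := two_mul_le_add_sq (1 / ‖s - ρ‖) (1 / ‖s' - ρ‖)
    have h7 : 0 < 1 / ‖s - ρ‖ * (1 / ‖s' - ρ‖) := by positivity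
    rw [← one_div_mul_one_div]
    simp only [one_div, inv_pow] at h6 h7 ⊢
    linarith
  calc ‖m‖ * ‖s' - s‖ / (‖s - ρ‖ * ‖s' - ρ‖)
      = ‖s' - s‖ * ‖m‖ * (1 / (‖s - ρ‖ * ‖s' - ρ‖)) := by ring
    _ ≤ ‖s' - s‖ * ‖m‖ * (1 / ‖s - ρ‖ ^ 2 + 1 / ‖s' - ρ‖ ^ 2) := by gcongr
    _ = _ := by ring

/-- Hadamard's theorem in the form of partial fractions of the logarithmic derivative, for entire
functions with zeros on the critical line. -/
theorem hasSum_logDeriv_of_zeros_on_line {f : ℂ → ℂ} (hf : Differentiable ℂ f) (h0 : f 0 ≠ 0)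
    (h01 : ‖f 1‖ = ‖f 0‖) (hre : ∀ ρ, f ρ = 0 → ρ.re = 1 / 2) {M : ℕ → ℝ}
    (hM0 : ∀ᶠ n in atTop, 0 < M n)
    (hM : ∀ᶠ n : ℕ in atTop, ∀ z : ℂ, ‖z‖ ≤ 2 * (n : ℝ) → ‖f z‖ ≤ ‖f 0‖ * Real.exp (M n))
    (hMlim : Tendsto (fun n : ℕ => M n / (n : ℝ) ^ 2) atTop (𝓝 0)) :
    (∀ s : ℂ, 1 / 2 < s.re → HasSum (fun ρ => (analyticOrderNatAt f ρ : ℝ) / ‖s - ρ‖ ^ 2)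
      ((logDeriv f s).re / (s.re - 1 / 2))) ∧
    (∀ s s' : ℂ, 1 / 2 < s.re → 1 / 2 < s'.re →
      HasSum (fun ρ => (analyticOrderNatAt f ρ : ℂ) / (s - ρ)
        - (analyticOrderNatAt f ρ : ℂ) / (s' - ρ)) (logDeriv f s - logDeriv f s')) := by
  have hord := analyticOrderAt_ne_top_of_differentiable hf h0
  set S : ℕ → Finset ℂ := fun n => (finite_closedBall_inter_zeros hf h0 n).toFinset with hSdef
  have hS : ∀ n ρ, ρ ∈ S n ↔ ‖ρ‖ ≤ n ∧ f ρ = 0 := by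
    intro n ρ
    simp [hSdef]
  have hzero : ∀ ρ, analyticOrderNatAt f ρ ≠ 0 → f ρ = 0 := fun ρ h =>
    apply_eq_zero_of_analyticOrderNatAt_ne_zero h
  have hSmem : ∀ ρ, analyticOrderNatAt f ρ ≠ 0 → ∀ᶠ n in atTop, ρ ∈ S n := by
    intro ρ h
    filter_upwards [eventually_ge_atTop ⌈‖ρ‖⌉₊] with n hn
    exact (hS n ρ).2 ⟨Nat.ceil_le.1 hn, hzero ρ h⟩
  have hfne : ∀ s : ℂ, 1 / 2 < s.re → f s ≠ 0 := fun s hs h => by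
    have := hre s h
    linarith
  have hlim0 : ∀ c : ℝ, Tendsto (fun n : ℕ => 128 * M n / (n : ℝ) ^ 2 * c) atTop (𝓝 0) := by
    intro c
    have := (hMlim.const_mul 128).mul_const c
    simp only [mul_zero, zero_mul] at this
    refine this.congr fun n => ?_
    ring
  -- Re q vanishes at some r in (0, 1) and q has Lipschitz constant 128 M/n² → 0, so real parts
  -- converge with no additive constant.
  have key : ∀ s : ℂ, 1 / 2 < s.re → ∀ᶠ n in atTop,
      |(logDeriv f s).re - (∑ ρ ∈ S n, (analyticOrderNatAt f ρ : ℂ) / (s - ρ)).re| ≤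
        128 * M n / (n : ℝ) ^ 2 * (‖s‖ + 1) := by
    intro s hs
    filter_upwards [hM0, hM, eventually_ge_atTop (⌈4 * (‖s‖ + 1)⌉₊)] with n hn0 hn1 hn2
    have hn3 : 4 * (‖s‖ + 1) ≤ n := Nat.ceil_le.1 hn2
    have hn4 : (4 : ℝ) ≤ n := by linarith [norm_nonneg s]
    obtain ⟨q, hq1, hq2, hq3⟩ := exists_logDeriv_eq_sum_add hf hord hn4 hn0 hn1 (hS n)
    obtain ⟨r, hr, hqr⟩ := hq3 (fun ρ hρ => hre ρ ((hS n ρ).1 hρ).2) h01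
    have hrn : ‖(r : ℂ)‖ ≤ 1 := by
      rw [norm_real, Real.norm_eq_abs, abs_of_pos hr.1]
      exact hr.2.le
    rw [hq1 s (hfne s hs), add_re, add_sub_cancel_left]
    have h1 : (q s).re = (q s - q r).re := by rw [sub_re, hqr, sub_zero]
    rw [h1]
    refine (abs_re_le_norm _).trans ((hq2 s r (by linarith) (by linarith)).trans ?_)
    refine mul_le_mul_of_nonneg_left ?_ (by positivity)
    exact (norm_sub_le _ _).trans (by linarith)
  -- Only the difference q(s) - q(s') occurs here, so no normalisation of q is needed.
  have key2 : ∀ s s' : ℂ, 1 / 2 < s.re → 1 / 2 < s'.re → ∀ᶠ n in atTop,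
      ‖∑ ρ ∈ S n, ((analyticOrderNatAt f ρ : ℂ) / (s - ρ)
        - (analyticOrderNatAt f ρ : ℂ) / (s' - ρ)) - (logDeriv f s - logDeriv f s')‖ ≤
        128 * M n / (n : ℝ) ^ 2 * ‖s - s'‖ := by
    intro s s' hs hs'
    filter_upwards [hM0, hM, eventually_ge_atTop (⌈4 * (‖s‖ + ‖s'‖ + 1)⌉₊)] with n hn0 hn1 hn2
    have hn3 : 4 * (‖s‖ + ‖s'‖ + 1) ≤ n := Nat.ceil_le.1 hn2
    have hn4 : (4 : ℝ) ≤ n := by linarith [norm_nonneg s, norm_nonneg s']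
    obtain ⟨q, hq1, hq2, -⟩ := exists_logDeriv_eq_sum_add hf hord hn4 hn0 hn1 (hS n)
    rw [hq1 s (hfne s hs), hq1 s' (hfne s' hs'), Finset.sum_sub_distrib]
    refine le_trans (le_of_eq ?_) (hq2 s s' (by linarith [norm_nonneg s'])
      (by linarith [norm_nonneg s]))
    rw [← norm_neg]
    congr 1
    ring
  have hX2 : ∀ s : ℂ, 1 / 2 < s.re → HasSum (fun ρ => (analyticOrderNatAt f ρ : ℝ) / ‖s - ρ‖ ^ 2)
      ((logDeriv f s).re / (s.re - 1 / 2)) := by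
    intro s hs
    have ha : 0 < s.re - 1 / 2 := by linarith
    refine hasSum_of_exhaust_of_nonneg (S := S) (fun ρ h => hSmem ρ ?_) (fun ρ => by positivity) ?_
    · intro h'
      simp [h'] at h
    · have h1 : Tendsto (fun n => (∑ ρ ∈ S n, (analyticOrderNatAt f ρ : ℂ) / (s - ρ)).re) atTop
          (𝓝 (logDeriv f s).re) := by
        rw [tendsto_iff_dist_tendsto_zero]
        refine squeeze_zero' (Eventually.of_forall fun n => dist_nonneg) ?_ (hlim0 (‖s‖ + 1))
        filter_upwards [key s hs] with n hn
        rwa [dist_comm, Real.dist_eq]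
      -- As Re ρ = 1/2, Re 1/(s - ρ) = (Re s - 1/2)/|s - ρ|²: all terms have one sign.
      refine (h1.div_const (s.re - 1 / 2)).congr fun n => ?_
      rw [re_sum, Finset.sum_div]
      refine Finset.sum_congr rfl fun ρ hρ => ?_
      have hρ := hre ρ ((hS n ρ).1 hρ).2
      rw [div_re, normSq_eq_norm_sq, sub_re, hρ]
      have hne : s.re - 1 / 2 ≠ 0 := ha.ne'
      simp only [natCast_re, natCast_im, zero_mul, zero_div, add_zero]
      rw [div_right_comm, mul_div_cancel_right₀ _ hne]
  refine ⟨hX2, fun s s' hs hs' => ?_⟩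
  have hsum : Summable fun ρ => ‖(analyticOrderNatAt f ρ : ℂ) / (s - ρ)
        - (analyticOrderNatAt f ρ : ℂ) / (s' - ρ)‖ := by
    refine Summable.of_nonneg_of_le (fun _ => norm_nonneg _) (fun ρ => ?_)
      (((hX2 s hs).summable.add (hX2 s' hs').summable).mul_left ‖s' - s‖)
    by_cases h : analyticOrderNatAt f ρ = 0
    · simp [h]
    · have hρ := hre ρ (hzero ρ h)
      refine (norm_div_sub_div_le ?_ ?_).trans (le_of_eq ?_)
      · rintro rfl; linarith
      · rintro rfl; linarith
      · simp
  have h1 := tendsto_sum_of_exhaust (S := S) (fun ρ h => hSmem ρ (by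
    intro h'
    simp [h'] at h)) hsum
  have h2 : Tendsto (fun n => ∑ ρ ∈ S n, ((analyticOrderNatAt f ρ : ℂ) / (s - ρ)
        - (analyticOrderNatAt f ρ : ℂ) / (s' - ρ))) atTop (𝓝 (logDeriv f s - logDeriv f s')) := by
    rw [tendsto_iff_norm_sub_tendsto_zero]
    exact squeeze_zero' (Eventually.of_forall fun n => norm_nonneg _) (key2 s s' hs hs')
      (hlim0 ‖s - s'‖)
  rw [tendsto_nhds_unique h2 h1]
  exact hsum.of_norm.hasSum

end Hadamard

/-! ### The xi function: zeros and growth. -/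

section Xi

open Complex Metric Set Filter Topology MeasureTheory

/-- The entire function `s (1 - s) π^{-s/2} Γ(s/2) ζ(s)`. -/
noncomputable def riemannXi (s : ℂ) : ℂ := s * (1 - s) * completedRiemannZeta₀ s - 1

theorem differentiable_riemannXi : Differentiable ℂ riemannXi := by
  have := differentiable_completedZeta₀
  unfold riemannXi
  fun_prop

theorem riemannXi_zero : riemannXi 0 = -1 := by simp [riemannXi]

theorem riemannXi_one : riemannXi 1 = -1 := by simp [riemannXi]

theorem riemannXi_one_sub (s : ℂ) : riemannXi (1 - s) = riemannXi s := by
  simp only [riemannXi, completedRiemannZeta₀_one_sub]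
  ring

theorem riemannXi_eq {s : ℂ} (h0 : s ≠ 0) (h1 : s ≠ 1) :
    riemannXi s = s * (1 - s) * completedRiemannZeta s := by
  have : 1 - s ≠ 0 := sub_ne_zero.2 h1.symm
  rw [riemannXi, completedRiemannZeta_eq]
  field_simp
  ring

theorem riemannXi_eq_mul_riemannZeta {s : ℂ} (hs : 0 < s.re) (h1 : s ≠ 1) :
    riemannXi s = s * (1 - s) * (Gammaℝ s * riemannZeta s) := by
  have h0 : s ≠ 0 := by rintro rfl; simp at hs
  rw [riemannXi_eq h0 h1, riemannZeta_def_of_ne_zero h0,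
    mul_div_cancel₀ _ (Gammaℝ_ne_zero_of_re_pos hs)]

theorem RiemannHypothesis.re_eq_of_riemannZeta_eq_zero (hRH : RiemannHypothesis) {s : ℂ}
    (hs : 0 < s.re) (h : riemannZeta s = 0) : s.re = 1 / 2 := by
  refine hRH s h ?_ ?_
  · rintro ⟨n, rfl⟩
    simp at hs
    norm_cast at hs
  · rintro rfl
    exact riemannZeta_one_ne_zero h

theorem RiemannHypothesis.re_eq_of_riemannXi_eq_zero (hRH : RiemannHypothesis) {s : ℂ}
    (h : riemannXi s = 0) : s.re = 1 / 2 := by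
  have key : ∀ s : ℂ, 0 < s.re → riemannXi s = 0 → s.re = 1 / 2 := by
    intro s hs h
    have h1 : s ≠ 1 := by rintro rfl; simp [riemannXi_one] at h
    have h0 : s ≠ 0 := by rintro rfl; simp at hs
    rw [riemannXi_eq_mul_riemannZeta hs h1] at h
    refine hRH.re_eq_of_riemannZeta_eq_zero hs ?_
    simpa [h0, sub_ne_zero.2 h1.symm, Gammaℝ_ne_zero_of_re_pos hs] using h
  rcases lt_or_ge 0 s.re with hs | hs
  · exact key s hs h
  · have := key (1 - s) (by simp; linarith) (by rw [riemannXi_one_sub, h])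
    simp at this
    linarith

/-- t^{σ-1} is at most t^{b-1} for t ≥ 1 and at most t^{a-1} for t ≤ 1. The resulting bound is
uniform in the imaginary part. -/
theorem norm_mellin_le_add {f : ℝ → ℂ} {a b : ℝ} (ha : MellinConvergent f (a : ℂ))
    (hb : MellinConvergent f (b : ℂ)) {s : ℂ} (has : a ≤ s.re) (hsb : s.re ≤ b) :
    ‖mellin f s‖ ≤ (∫ t in Ioi (0 : ℝ), ‖(t : ℂ) ^ ((a : ℂ) - 1) • f t‖) +
      ∫ t in Ioi (0 : ℝ), ‖(t : ℂ) ^ ((b : ℂ) - 1) • f t‖ := by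
  rw [mellin, ← integral_add ha.norm hb.norm]
  refine norm_integral_le_of_norm_le (ha.norm.add hb.norm) ?_
  refine (ae_restrict_iff' measurableSet_Ioi).2 (Eventually.of_forall fun t ht => ?_)
  have ht : 0 < t := ht
  simp only [norm_smul, norm_cpow_eq_rpow_re_of_pos ht, sub_re, one_re, ofReal_re]
  rw [← add_mul]
  refine mul_le_mul_of_nonneg_right ?_ (norm_nonneg _)
  have h1 := Real.rpow_pos_of_pos ht (a - 1)
  have h2 := Real.rpow_pos_of_pos ht (b - 1)
  rcases le_total 1 t with h | h
  · have := Real.rpow_le_rpow_of_exponent_le h (show s.re - 1 ≤ b - 1 by linarith)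
    linarith
  · have := Real.rpow_le_rpow_of_exponent_ge ht h (show a - 1 ≤ s.re - 1 by linarith)
    linarith

theorem exists_norm_completedRiemannZeta₀_le (a b : ℝ) :
    ∃ K, ∀ s : ℂ, a ≤ s.re → s.re ≤ b → ‖completedRiemannZeta₀ s‖ ≤ K := by
  have hc : ∀ s, MellinConvergent (HurwitzZeta.hurwitzEvenFEPair 0).f_modif s := fun s =>
    ((HurwitzZeta.hurwitzEvenFEPair 0).isStrongFEPair_toStrongFEPair.hasMellin s).1
  refine ⟨(∫ t in Ioi (0 : ℝ), ‖(t : ℂ) ^ (((a / 2 : ℝ) : ℂ) - 1) •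
    (HurwitzZeta.hurwitzEvenFEPair 0).f_modif t‖) + ∫ t in Ioi (0 : ℝ),
    ‖(t : ℂ) ^ (((b / 2 : ℝ) : ℂ) - 1) • (HurwitzZeta.hurwitzEvenFEPair 0).f_modif t‖,
    fun s hs hs' => ?_⟩
  -- By definition this is half the Mellin transform, at s/2, of the modified theta kernel, which
  -- converges for every exponent.
  have h1 : completedRiemannZeta₀ s =
      mellin (HurwitzZeta.hurwitzEvenFEPair 0).f_modif (s / 2) / 2 := rfl
  have h2 := norm_mellin_le_add (hc ((a / 2 : ℝ) : ℂ)) (hc ((b / 2 : ℝ) : ℂ)) (s := s / 2)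
    (by simp; linarith) (by simp; linarith)
  rw [h1, norm_div]
  refine (div_le_self (norm_nonneg _) ?_).trans h2
  simp

theorem norm_Gamma_le_Gamma_re {s : ℂ} (hs : 0 < s.re) : ‖Gamma s‖ ≤ Real.Gamma s.re := by
  rw [Gamma_eq_integral hs, Real.Gamma_eq_integral hs, GammaIntegral]
  refine norm_integral_le_of_norm_le (Real.GammaIntegral_convergent hs) ?_
  refine (ae_restrict_iff' measurableSet_Ioi).2 (Eventually.of_forall fun t ht => ?_)
  have ht : 0 < t := ht
  rw [norm_mul, norm_real, Real.norm_of_nonneg (Real.exp_pos _).le,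
    norm_cpow_eq_rpow_re_of_pos ht]
  simp

theorem Real.Gamma_le_factorial {y : ℝ} {n : ℕ} (hy : 1 ≤ y) (hyn : y ≤ n) :
    Real.Gamma y ≤ n.factorial := by
  have h1 : Real.Gamma (y + 1) = y * Real.Gamma y := Real.Gamma_add_one (by linarith)
  have h2 := Real.Gamma_pos_of_pos (show 0 < y by linarith)
  -- Monotonicity is available only on [2, ∞), hence the shift: Γ(y) ≤ y Γ(y) = Γ(y + 1) ≤ Γ(n + 1).
  have h3 := Real.Gamma_strictMonoOn_Ici.monotoneOn (a := y + 1) (b := n + 1)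
    (by simp; linarith) (by simp; linarith) (by linarith)
  rw [Real.Gamma_nat_eq_factorial] at h3
  nlinarith

theorem exists_norm_riemannZeta_le : ∃ K, ∀ s : ℂ, 2 ≤ s.re → ‖riemannZeta s‖ ≤ K := by
  refine ⟨∑' n : ℕ, 1 / ((n : ℝ) + 1) ^ 2, fun s hs => ?_⟩
  have hsum : Summable fun n : ℕ => 1 / ((n : ℝ) + 1) ^ 2 := by
    have := (summable_nat_add_iff 1).2 (Real.summable_one_div_nat_pow.2 (show 1 < 2 by norm_num))
    simpa using this
  rw [zeta_eq_tsum_one_div_nat_add_one_cpow (by linarith)]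
  refine tsum_of_norm_bounded hsum.hasSum fun n => ?_
  have hn : (0 : ℝ) < (n : ℝ) + 1 := by positivity
  have : ‖((n : ℂ) + 1) ^ s‖ = ((n : ℝ) + 1) ^ s.re := by
    rw [← norm_cpow_eq_rpow_re_of_pos hn]
    push_cast
    rfl
  rw [norm_div, norm_one, this]
  refine one_div_le_one_div_of_le (by positivity) ?_
  rw [← Real.rpow_natCast]
  exact Real.rpow_le_rpow_of_exponent_le (by linarith [n.cast_nonneg (α := ℝ)]) (by simpa using hs)

/-- Three regions: the Mellin bound on -1 ≤ Re s ≤ 2, the factors Γ(s/2) and ζ(s) to the right, and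
the functional equation to the left. Reflection can raise the real part to 2n + 1, which accounts
for (n + 1)! in place of n!. -/
theorem exists_norm_completedRiemannZeta₀_le_factorial :
    ∃ K, 0 ≤ K ∧ ∀ n : ℕ, ∀ s : ℂ, ‖s‖ ≤ 2 * n → 
      ‖completedRiemannZeta₀ s‖ ≤ K * (n + 1).factorial := by
  obtain ⟨K₁, hK₁⟩ := exists_norm_completedRiemannZeta₀_le (-1) 2
  obtain ⟨K₂, hK₂⟩ := exists_norm_riemannZeta_le
  have hK₁0 : 0 ≤ K₁ := (norm_nonneg _).trans (hK₁ 0 (by simp) (by simp))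
  have hK₂0 : 0 ≤ K₂ := (norm_nonneg _).trans (hK₂ 2 (by simp))
  have hfac : ∀ n : ℕ, (1 : ℝ) ≤ (n + 1).factorial := fun n => by
    exact_mod_cast (n + 1).factorial_pos
  have right : ∀ n : ℕ, ∀ s : ℂ, 2 ≤ s.re → s.re ≤ 2 * (n + 1 : ℕ) →
      ‖completedRiemannZeta₀ s‖ ≤ (K₁ + K₂ + 2) * (n + 1).factorial := by
    intro n s hs hsn
    have h0 : s ≠ 0 := by rintro rfl; norm_num at hs
    have h1 : s ≠ 1 := by rintro rfl; norm_num at hs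
    have e : completedRiemannZeta₀ s = Gammaℝ s * riemannZeta s + 1 / s + 1 / (1 - s) := by
      rw [riemannZeta_def_of_ne_zero h0, mul_div_cancel₀ _
        (Gammaℝ_ne_zero_of_re_pos (by linarith)), completedRiemannZeta_eq]
      ring
    have hG : ‖Gammaℝ s‖ ≤ (n + 1).factorial := by
      rw [Gammaℝ_def, norm_mul]
      have h2 : ‖(Real.pi : ℂ) ^ (-s / 2)‖ ≤ 1 := by
        rw [norm_cpow_eq_rpow_re_of_pos Real.pi_pos]
        refine Real.rpow_le_one_of_one_le_of_nonpos (by linarith [Real.pi_gt_three]) ?_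
        simp
        linarith
      have h3 : ‖Gamma (s / 2)‖ ≤ (n + 1).factorial := by
        have hre : (s / 2).re = s.re / 2 := by simp
        refine (norm_Gamma_le_Gamma_re (by rw [hre]; linarith)).trans ?_
        rw [hre]
        exact Real.Gamma_le_factorial (by linarith) (by linarith)
      calc _ ≤ 1 * ((n + 1).factorial : ℝ) := mul_le_mul h2 h3 (norm_nonneg _) zero_le_one
        _ = _ := one_mul _
    have hs1 : ‖1 / s‖ ≤ 1 := by
      rw [norm_div, norm_one]
      refine div_le_one_of_le₀ ?_ (norm_nonneg _)
      have := re_le_norm s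
      linarith
    have hs2 : ‖1 / (1 - s)‖ ≤ 1 := by
      rw [norm_div, norm_one]
      refine div_le_one_of_le₀ ?_ (norm_nonneg _)
      have := re_le_norm (s - 1)
      rw [norm_sub_rev]
      simp at this
      linarith
    rw [e]
    have h4 : ‖Gammaℝ s * riemannZeta s‖ ≤ (n + 1).factorial * K₂ := by
      rw [norm_mul]
      exact mul_le_mul hG (hK₂ s hs) (norm_nonneg _) (by positivity)
    have h5 := norm_add₃_le (a := Gammaℝ s * riemannZeta s) (b := 1 / s) (c := 1 / (1 - s))
    nlinarith [hfac n]
  refine ⟨K₁ + K₂ + 2, by positivity, fun n s hs => ?_⟩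
  have hre := abs_le.1 ((abs_re_le_norm s).trans hs)
  rcases le_or_gt 2 s.re with h | h
  · exact right n s h (by push_cast; linarith [hre.2])
  rcases le_or_gt (-1) s.re with h' | h'
  · have := hK₁ s h' h.le
    nlinarith [hfac n]
  · rw [← completedRiemannZeta₀_one_sub]
    refine right n (1 - s) (by simp; linarith) ?_
    simp only [sub_re, one_re]
    push_cast
    linarith [hre.1]

/-- The growth is exp(O(n log n)), hence o(n²) in the exponent, as the partial fraction theorem
demands. -/
theorem exists_norm_riemannXi_le :
    ∃ M : ℕ → ℝ, (∀ᶠ n in atTop, 0 < M n) ∧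
      (∀ᶠ n : ℕ in atTop, ∀ z : ℂ, ‖z‖ ≤ 2 * (n : ℝ) →
        ‖riemannXi z‖ ≤ ‖riemannXi 0‖ * Real.exp (M n)) ∧
      Tendsto (fun n : ℕ => M n / (n : ℝ) ^ 2) atTop (𝓝 0) := by
  obtain ⟨K, hK0, hK⟩ := exists_norm_completedRiemannZeta₀_le_factorial
  -- The exponent n + 3 adds 2 from s(1 - s) to n + 1 from (n + 1)! ≤ (n + 1)^{n+1}; the 6 comes
  -- from 2n(1 + 2n) ≤ 6(n + 1)².
  refine ⟨fun n => Real.log (6 * K + 2) + (n + 3) * Real.log (n + 1), ?_, ?_, ?_⟩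
  · refine Eventually.of_forall fun n => ?_
    have h1 : 0 < Real.log (6 * K + 2) := Real.log_pos (by linarith)
    have h2 : 0 ≤ Real.log ((n : ℝ) + 1) := Real.log_nonneg (by linarith [n.cast_nonneg (α := ℝ)])
    positivity
  · refine Eventually.of_forall fun n z hz => ?_
    have hn : (0 : ℝ) < n + 1 := by positivity
    rw [riemannXi_zero, norm_neg, norm_one, one_mul, Real.exp_add, Real.exp_log (by positivity)]
    have e : Real.exp ((n + 3) * Real.log (n + 1)) = ((n : ℝ) + 1) ^ (n + 3) := by
      rw [show ((n : ℝ) + 3) * Real.log (n + 1) = ((n + 3 : ℕ) : ℝ) * Real.log (n + 1) by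
        push_cast; ring, Real.exp_nat_mul, Real.exp_log hn]
    rw [e]
    have h1 : ‖z * (1 - z)‖ ≤ 6 * ((n : ℝ) + 1) ^ 2 := by
      rw [norm_mul]
      have : ‖1 - z‖ ≤ 1 + 2 * n := (norm_sub_le _ _).trans (by rw [norm_one]; linarith)
      calc ‖z‖ * ‖1 - z‖ ≤ (2 * n) * (1 + 2 * n) :=
            mul_le_mul hz this (norm_nonneg _) (by positivity)
        _ ≤ _ := by nlinarith [n.cast_nonneg (α := ℝ)]
    have h2 : ((n + 1).factorial : ℝ) ≤ ((n : ℝ) + 1) ^ (n + 1) := by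
      exact_mod_cast (n + 1).factorial_le_pow
    have h3 := hK n z hz
    have h4 : (1 : ℝ) ≤ ((n : ℝ) + 1) ^ (n + 3) := one_le_pow₀ (by linarith [n.cast_nonneg (α := ℝ)])
    calc ‖riemannXi z‖ ≤ ‖z * (1 - z) * completedRiemannZeta₀ z‖ + ‖(1 : ℂ)‖ := norm_sub_le _ _
      _ ≤ 6 * ((n : ℝ) + 1) ^ 2 * (K * ((n : ℝ) + 1) ^ (n + 1)) + 1 := by
          rw [norm_mul, norm_one]
          gcongr
          exact h3.trans (by gcongr)
      _ = 6 * K * ((n : ℝ) + 1) ^ (n + 3) + 1 := by ring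
      _ ≤ _ := by nlinarith
  · have h1 : Tendsto (fun n : ℕ => Real.log ((n : ℝ) + 1) / ((n : ℝ) + 1)) atTop (𝓝 0) := by
      have := Real.isLittleO_log_id_atTop.tendsto_div_nhds_zero.comp
        (tendsto_atTop_add_const_right atTop (1 : ℝ) (tendsto_natCast_atTop_atTop (R := ℝ)))
      simpa [Function.comp_def] using this
    have h2 : Tendsto (fun n : ℕ => 1 / (n : ℝ)) atTop (𝓝 0) := tendsto_one_div_atTop_nhds_zero_nat
    have h3 : Tendsto (fun n : ℕ => Real.log (6 * K + 2) * (1 / (n : ℝ)) * (1 / (n : ℝ)) +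
        (1 + 3 * (1 / (n : ℝ))) * (1 + 1 / (n : ℝ)) * (Real.log ((n : ℝ) + 1) / ((n : ℝ) + 1)))
        atTop (𝓝 (Real.log (6 * K + 2) * 0 * 0 + (1 + 3 * 0) * (1 + 0) * 0)) :=
      ((tendsto_const_nhds.mul h2).mul h2).add
        (((tendsto_const_nhds.add (tendsto_const_nhds.mul h2)).mul
          (tendsto_const_nhds.add h2)).mul h1)
    simp only [mul_zero, add_zero] at h3
    refine h3.congr' ?_
    filter_upwards [eventually_gt_atTop 0] with n hn
    have hn' : (n : ℝ) ≠ 0 := by positivity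
    have hn'' : (n : ℝ) + 1 ≠ 0 := by positivity
    field_simp

theorem RiemannHypothesis.hasSum_logDeriv_riemannXi (hRH : RiemannHypothesis) :
    (∀ s : ℂ, 1 / 2 < s.re →
      HasSum (fun ρ => (analyticOrderNatAt riemannXi ρ : ℝ) / ‖s - ρ‖ ^ 2)
        ((logDeriv riemannXi s).re / (s.re - 1 / 2))) ∧
    (∀ s s' : ℂ, 1 / 2 < s.re → 1 / 2 < s'.re →
      HasSum (fun ρ => (analyticOrderNatAt riemannXi ρ : ℂ) / (s - ρ)
        - (analyticOrderNatAt riemannXi ρ : ℂ) / (s' - ρ))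
        (logDeriv riemannXi s - logDeriv riemannXi s')) := by
  obtain ⟨M, h1, h2, h3⟩ := exists_norm_riemannXi_le
  exact hasSum_logDeriv_of_zeros_on_line differentiable_riemannXi (by simp [riemannXi_zero])
    (by rw [riemannXi_zero, riemannXi_one]) (fun ρ h => hRH.re_eq_of_riemannXi_eq_zero h) h1 h2 h3

end Xi

/-! ### The digamma function: series and an upper bound. -/

section Digamma

open Complex Metric Set Filter Topology MeasureTheory

/-- Pointwise convergence of locally bounded holomorphic functions implies convergence of the
derivatives. -/
theorem tendsto_deriv_of_tendsto_of_bounded {f : ℕ → ℂ → ℂ} {g : ℂ → ℂ} {z : ℂ} {r K : ℝ}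
    {U : Set ℂ} (hU : IsOpen U) (hr : 0 < r) (hzr : closedBall z r ⊆ U)
    (hf : ∀ᶠ n in atTop, DifferentiableOn ℂ (f n) U) (hg : DifferentiableOn ℂ g U)
    (hb : ∀ᶠ n in atTop, ∀ w ∈ sphere z r, ‖f n w‖ ≤ K)
    (hlim : ∀ w ∈ sphere z r, Tendsto (fun n => f n w) atTop (𝓝 (g w))) :
    Tendsto (fun n => deriv (f n) z) atTop (𝓝 (deriv g z)) := by
  -- Cauchy's formula writes the derivatives as integrals over the circle, where dominated
  -- convergence replaces locally uniform convergence.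
  rw [← cderiv_eq_deriv hU hg hr hzr]
  have h1 : Tendsto (fun n => cderiv r (f n) z) atTop (𝓝 (cderiv r g z)) := by
    unfold cderiv circleIntegral
    refine Tendsto.const_smul ?_ _
    refine intervalIntegral.tendsto_integral_filter_of_dominated_convergence
      (fun _ => r * ((r ^ 2)⁻¹ * K)) ?_ ?_ ?_ ?_
    · filter_upwards [hf] with n hn
      have hc : Continuous fun θ : ℝ => f n (circleMap z r θ) :=
        hn.continuousOn.comp_continuous (continuous_circleMap z r) fun θ =>
          hzr (circleMap_mem_closedBall z hr.le θ)
      have hc2 : Continuous fun θ : ℝ => ((circleMap z r θ - z) ^ 2)⁻¹ := by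
        refine Continuous.inv₀ (by fun_prop) fun θ => pow_ne_zero _ ?_
        exact sub_ne_zero.2 (circleMap_ne_center hr.ne')
      simp only [deriv_circleMap]
      have hc1 : Continuous fun θ : ℝ => circleMap 0 r θ * I := by fun_prop
      exact (hc1.smul (hc2.smul hc)).aestronglyMeasurable
    · filter_upwards [hb] with n hn
      refine Eventually.of_forall fun θ _ => ?_
      rw [norm_smul, norm_smul, deriv_circleMap, norm_mul, norm_inv, norm_pow,
        circleMap_sub_center, norm_circleMap_zero, norm_I, mul_one, abs_of_pos hr]
      gcongr
      exact hn _ (circleMap_mem_sphere z hr.le θ)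
    · exact intervalIntegrable_const
    · refine Eventually.of_forall fun θ _ => ?_
      exact ((hlim _ (circleMap_mem_sphere z hr.le θ)).const_smul _).const_smul _
  refine h1.congr' ?_
  filter_upwards [hf] with n hn
  exact cderiv_eq_deriv hU hn hr hzr

/-- (1 - t/n)^n ≤ e^{-t} in Euler's integral. The bound is independent of n, as needed for
convergence of derivatives. -/
theorem norm_GammaSeq_le {s : ℂ} (hs : 0 < s.re) {n : ℕ} (hn : n ≠ 0) :
    ‖GammaSeq s n‖ ≤ Real.Gamma s.re := by
  rw [GammaSeq_eq_approx_Gamma_integral hs hn, Real.Gamma_eq_integral hs,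
    intervalIntegral.integral_of_le (by positivity)]
  have hint := Real.GammaIntegral_convergent hs
  refine (norm_integral_le_of_norm_le (hint.mono_set Ioc_subset_Ioi_self) ?_).trans
    (setIntegral_mono_set hint ?_ (LE.le.eventuallyLE Ioc_subset_Ioi_self))
  · refine (ae_restrict_iff' measurableSet_Ioc).2 (Eventually.of_forall fun t ht => ?_)
    have h1 : (0 : ℝ) < n := by positivity
    have h2 : 0 ≤ 1 - t / n := sub_nonneg.2 (div_le_one_of_le₀ ht.2 h1.le)
    rw [norm_mul, norm_real, Real.norm_of_nonneg (pow_nonneg h2 _),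
      norm_cpow_eq_rpow_re_of_pos ht.1, sub_re, one_re]
    refine mul_le_mul_of_nonneg_right ?_ (Real.rpow_nonneg ht.1.le _)
    exact Real.one_sub_div_pow_le_exp_neg ht.2
  · refine (ae_restrict_iff' measurableSet_Ioi).2 (Eventually.of_forall fun t ht => ?_)
    have ht : 0 < t := ht
    show 0 ≤ Real.exp (-t) * t ^ (s.re - 1)
    positivity

theorem GammaSeq_denominator_ne_zero {s : ℂ} (hs : 0 < s.re) (j : ℕ) : s + j ≠ 0 := by
  intro h
  have := congrArg re h
  simp at this
  linarith [j.cast_nonneg (α := ℝ)]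

theorem logDeriv_GammaSeq {s : ℂ} (hs : 0 < s.re) {n : ℕ} (hn : n ≠ 0) :
    DifferentiableAt ℂ (fun s => GammaSeq s n) s ∧
    logDeriv (fun s => GammaSeq s n) s = Real.log n - ∑ k ∈ Finset.range (n + 1), 1 / (s + k) := by
  have hn' : (n : ℂ) ≠ 0 := Nat.cast_ne_zero.2 hn
  have hpow : HasDerivAt (fun s : ℂ => (n : ℂ) ^ s * n.factorial)
      ((n : ℂ) ^ s * Complex.log n * n.factorial) s := by
    have := ((hasDerivAt_id s).const_cpow (c := (n : ℂ)) (Or.inl hn')).mul_const (n.factorial : ℂ)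
    simpa using this
  have hprod : DifferentiableAt ℂ (fun s : ℂ => ∏ j ∈ Finset.range (n + 1), (s + j)) s :=
    DifferentiableAt.fun_finsetProd fun i _ => by fun_prop
  have hP : ∏ j ∈ Finset.range (n + 1), (s + j) ≠ 0 :=
    Finset.prod_ne_zero_iff.2 fun j _ => GammaSeq_denominator_ne_zero hs j
  have hN : (n : ℂ) ^ s * n.factorial ≠ 0 :=
    mul_ne_zero (by simp [cpow_eq_zero_iff, hn]) (Nat.cast_ne_zero.2 n.factorial_ne_zero)
  unfold GammaSeq
  refine ⟨hpow.differentiableAt.div hprod hP, ?_⟩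
  rw [logDeriv_div s hN hP hpow.differentiableAt hprod, logDeriv_prod]
  · congr 1
    · rw [logDeriv_apply, hpow.deriv, ← natCast_log, mul_right_comm, mul_div_cancel_left₀ _ hN]
    · refine Finset.sum_congr rfl fun j _ => ?_
      rw [logDeriv_apply]
      simp
  · exact fun j _ => GammaSeq_denominator_ne_zero hs j
  · intro j _
    fun_prop

/-- Logarithmic derivative of Euler's product limit: the approximants are bounded near z and
converge pointwise to Γ, so their derivatives converge too. -/
theorem tendsto_digamma {z : ℂ} (hz : 0 < z.re) :
    Tendsto (fun n : ℕ => (Real.log n : ℂ) - ∑ k ∈ Finset.range (n + 1), 1 / (z + k)) atTop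
      (𝓝 (digamma z)) := by
  have hU : IsOpen {w : ℂ | 0 < w.re} := isOpen_lt continuous_const continuous_re
  have hre : ∀ w ∈ closedBall z (z.re / 2), z.re / 2 ≤ w.re ∧ w.re ≤ 3 * z.re / 2 := by
    intro w hw
    rw [mem_closedBall, dist_eq_norm] at hw
    have := abs_le.1 ((abs_re_le_norm _).trans hw)
    rw [sub_re] at this
    constructor <;> linarith [this.1, this.2]
  have hsub : closedBall z (z.re / 2) ⊆ {w : ℂ | 0 < w.re} := fun w hw => by
    have := (hre w hw).1
    show 0 < w.re
    linarith
  have hcont : ContinuousOn Real.Gamma (Icc (z.re / 2) (3 * z.re / 2)) := by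
    intro y hy
    refine (Real.differentiableAt_Gamma fun m => ?_).continuousAt.continuousWithinAt
    have := hy.1
    intro h
    have : (0 : ℝ) ≤ m := m.cast_nonneg
    linarith
  obtain ⟨K, hK⟩ := isCompact_Icc.exists_bound_of_continuousOn hcont
  have hd : Tendsto (fun n : ℕ => deriv (fun s => GammaSeq s n) z) atTop (𝓝 (deriv Gamma z)) := by
    refine tendsto_deriv_of_tendsto_of_bounded (K := K) hU (half_pos hz) hsub ?_ ?_ ?_
      fun w _ => GammaSeq_tendsto_Gamma w
    · filter_upwards [eventually_ne_atTop 0] with n hn w hw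
      exact (logDeriv_GammaSeq hw hn).1.differentiableWithinAt
    · intro w hw
      refine (differentiableAt_Gamma w fun m h => ?_).differentiableWithinAt
      have hw : 0 < w.re := hw
      rw [h] at hw
      simp at hw
      linarith [m.cast_nonneg (α := ℝ)]
    · filter_upwards [eventually_ne_atTop 0] with n hn w hw
      have hw' := hre w (sphere_subset_closedBall hw)
      refine (norm_GammaSeq_le (by linarith [hw'.1]) hn).trans ?_
      exact (le_abs_self _).trans (hK _ hw')
  have h2 := hd.div (GammaSeq_tendsto_Gamma z) (Gamma_ne_zero_of_re_pos hz)
  rw [digamma_def, logDeriv_apply]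
  refine h2.congr' ?_
  filter_upwards [eventually_ne_atTop 0] with n hn
  rw [← (logDeriv_GammaSeq hz hn).2, logDeriv_apply]
  rfl

theorem summable_one_div_norm_add_nat_sq {z : ℂ} (hz : 0 < z.re) :
    Summable fun k : ℕ => 1 / ‖z + k‖ ^ 2 := by
  rw [← summable_nat_add_iff 1]
  have := (summable_nat_add_iff 1).2 (Real.summable_one_div_nat_pow.2 (show 1 < 2 by norm_num))
  refine Summable.of_nonneg_of_le (fun _ => by positivity) (fun k => ?_) this
  refine one_div_le_one_div_of_le (by positivity) (pow_le_pow_left₀ (by positivity) ?_ 2)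
  refine le_trans ?_ (re_le_norm _)
  simp
  linarith

theorem hasSum_digamma_sub {z z' : ℂ} (hz : 0 < z.re) (hz' : 0 < z'.re) :
    HasSum (fun k : ℕ => 1 / (z' + k) - 1 / (z + k)) (digamma z - digamma z') := by
  have hsum : Summable fun k : ℕ => 1 / (z' + k) - 1 / (z + k) := by
    refine Summable.of_norm_bounded (((summable_one_div_norm_add_nat_sq hz').add
      (summable_one_div_norm_add_nat_sq hz)).mul_left ‖z - z'‖) fun k => ?_
    have := norm_div_sub_div_le (m := 1) (s := z') (s' := z) (ρ := -(k : ℂ))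
      (fun h => GammaSeq_denominator_ne_zero hz' k (by rw [h]; ring))
      (fun h => GammaSeq_denominator_ne_zero hz k (by rw [h]; ring))
    simpa using this
  have h1 := (hsum.hasSum.tendsto_sum_nat).comp (tendsto_add_atTop_nat 1)
  have h2 := (tendsto_digamma hz).sub (tendsto_digamma hz')
  have : digamma z - digamma z' = ∑' k : ℕ, (1 / (z' + k) - 1 / (z + k)) := by
    refine tendsto_nhds_unique h2 (h1.congr fun n => ?_)
    simp only [Function.comp, Finset.sum_sub_distrib]
    ring
  rw [this]
  exact hsum.hasSum

/-- |w + 1|²/|w|² = 1 + 2 Re(1/w) + 1/|w|², together with log X ≤ X - 1. -/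
theorem log_norm_add_one_sub_le {w : ℂ} (hw : 0 < w.re) :
    Real.log ‖w + 1‖ - Real.log ‖w‖ ≤ (1 / w).re + 1 / 2 * (1 / ‖w‖ ^ 2) := by
  have hw0 : w ≠ 0 := by rintro rfl; simp at hw
  have hw1 : w + 1 ≠ 0 := fun h => by
    have := congrArg re h
    simp at this
    linarith
  have hpos : 0 < ‖w + 1‖ / ‖w‖ := div_pos (norm_pos_iff.2 hw1) (norm_pos_iff.2 hw0)
  rw [← Real.log_div (norm_ne_zero_iff.2 hw1) (norm_ne_zero_iff.2 hw0)]
  have h1 := Real.log_le_sub_one_of_pos (pow_pos hpos 2)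
  rw [Real.log_pow] at h1
  have h2 : (‖w + 1‖ / ‖w‖) ^ 2 = 1 + 2 * (1 / w).re + 1 / ‖w‖ ^ 2 := by
    have h3 : ‖w + 1‖ ^ 2 = ‖w‖ ^ 2 + 2 * w.re + 1 := by
      rw [Complex.sq_norm, Complex.sq_norm, normSq_apply, normSq_apply]
      simp
      ring
    have h4 : ‖w‖ ^ 2 ≠ 0 := by simpa using hw0
    rw [div_pow, h3, one_div, inv_re, normSq_eq_norm_sq]
    field_simp
  push_cast at h1
  linarith

/-- Comparing Re 1/(z + k) with log|z + k + 1| - log|z + k| telescopes the Euler limit; the errors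
sum to at most half of ζ(2). An upper bound suffices, since digamma enters ζ'/ζ with a minus sign.
-/
theorem re_digamma_le {z : ℂ} (hz : 1 ≤ z.re) :
    (digamma z).re ≤ Real.log ‖z‖ + Real.pi ^ 2 / 12 := by
  have hz0 : 0 < z.re := by linarith
  have h1 := (continuous_re.tendsto _).comp (tendsto_digamma hz0)
  refine le_of_tendsto h1 ?_
  filter_upwards [eventually_gt_atTop 0] with n hn
  simp only [Function.comp, sub_re, ofReal_re, re_sum]
  have h2 : ∑ k ∈ Finset.range (n + 1), (Real.log ‖z + (k + 1 : ℕ)‖ - Real.log ‖z + k‖) ≤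
      ∑ k ∈ Finset.range (n + 1), ((1 / (z + k)).re + 1 / 2 * (1 / ‖z + k‖ ^ 2)) := by
    refine Finset.sum_le_sum fun k _ => ?_
    have := log_norm_add_one_sub_le (w := z + k) (by
      simp
      linarith [k.cast_nonneg (α := ℝ)])
    rwa [add_assoc, ← Nat.cast_add_one] at this
  rw [Finset.sum_range_sub (fun k : ℕ => Real.log ‖z + k‖), Finset.sum_add_distrib,
    ← Finset.mul_sum] at h2
  have h3 : ∑ k ∈ Finset.range (n + 1), 1 / ‖z + k‖ ^ 2 ≤ Real.pi ^ 2 / 6 := by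
    have hz2 : HasSum (fun k : ℕ => 1 / ((k : ℝ) + 1) ^ 2) (Real.pi ^ 2 / 6) := by
      have := (hasSum_nat_add_iff' 1).2 hasSum_zeta_two
      simpa using this
    refine le_trans (Finset.sum_le_sum fun k _ => ?_)
      (sum_le_hasSum (Finset.range (n + 1)) (fun _ _ => by positivity) hz2)
    refine one_div_le_one_div_of_le (by positivity) (pow_le_pow_left₀ (by positivity) ?_ 2)
    refine le_trans ?_ (re_le_norm _)
    simp
    linarith
  have h4 : Real.log n ≤ Real.log ‖z + (n + 1 : ℕ)‖ := by
    refine Real.log_le_log (by positivity) (le_trans ?_ (re_le_norm _))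
    simp
    linarith
  simp only [Nat.cast_zero, add_zero] at h2
  linarith

end Digamma

/-! ### Laplace transforms: uniqueness and termwise evaluation. -/

section Laplace

open Complex Metric Set Filter Topology MeasureTheory
open scoped FourierTransform

/-- A function on the positive reals is determined by its Laplace transform on a vertical line. -/
theorem eq_zero_of_laplace_eq_zero {φ : ℝ → ℂ} {c : ℝ} (hc : ContinuousOn φ (Ioi 0))
    (hi : IntegrableOn (fun v : ℝ => exp (-(c : ℂ) * v) * φ v) (Ioi 0))
    (h0 : ∀ w : ℂ, w.re = c → ∫ v in Ioi (0 : ℝ), exp (-w * v) * φ v = 0) {v : ℝ} (hv : 0 < v) :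
    φ v = 0 := by
  set f : ℝ → ℂ := (Ioi (0 : ℝ)).indicator fun v : ℝ => exp (-(c : ℂ) * v) * φ v with hf
  have hfi : Integrable f := (integrable_indicator_iff measurableSet_Ioi).2 hi
  have hF : 𝓕 f = 0 := by
    ext ξ
    rw [Real.fourier_real_eq_integral_exp_smul]
    have h1 : (fun v : ℝ => exp (((-2 * Real.pi * v * ξ : ℝ) : ℂ) * I) • f v) =
        (Ioi (0 : ℝ)).indicator fun v : ℝ =>
          exp (-((c : ℂ) + (2 * Real.pi * ξ : ℝ) * I) * v) * φ v := by
      ext v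
      by_cases hv : v ∈ Ioi (0 : ℝ)
      · rw [hf, indicator_of_mem hv, indicator_of_mem hv, smul_eq_mul, ← mul_assoc, ← exp_add]
        congr 2
        push_cast
        ring
      · rw [hf, indicator_of_notMem hv, indicator_of_notMem hv, smul_zero]
    rw [h1, integral_indicator measurableSet_Ioi]
    exact h0 _ (by simp)
  have hcont : ContinuousAt f v := by
    have h1 : ContinuousAt (fun v : ℝ => exp (-(c : ℂ) * v) * φ v) v :=
      (by fun_prop : Continuous fun v : ℝ => exp (-(c : ℂ) * v)).continuousAt.mul
        (hc.continuousAt (Ioi_mem_nhds hv))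
    refine h1.congr ?_
    filter_upwards [Ioi_mem_nhds hv] with y hy
    rw [hf, indicator_of_mem hy]
  -- The Fourier transform is zero, hence integrable, so inversion holds at the continuity point v.
  have h2 := hfi.fourierInv_fourier_eq (by rw [hF]; exact integrable_zero _ _ _) hcont
  rw [hF, Real.fourierInv_eq'] at h2
  simp only [Pi.zero_apply, smul_zero, integral_zero] at h2
  rw [hf, indicator_of_mem (show v ∈ Ioi (0 : ℝ) from hv)] at h2
  exact (mul_eq_zero.1 h2.symm).resolve_left (exp_ne_zero _)

section LaplaceSeries

variable {ι : Type*} {f : ι → ℝ → ℂ} {c : ι → ℝ}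

/-- The common growth rate 3/2 exceeds the exponents that occur, which have real part at most 1, and
stays below the abscissa 2 of the transforms. -/
theorem summable_of_norm_le_mul_exp (hc : Summable c)
    (hb : ∀ i v, 0 < v → ‖f i v‖ ≤ c i * Real.exp (3 / 2 * v)) {v : ℝ} (hv : 0 < v) :
    Summable fun i => f i v :=
  Summable.of_norm_bounded (hc.mul_right _) fun i => hb i v hv

theorem continuousOn_tsum_of_norm_le_mul_exp (hf : ∀ i, Continuous (f i)) (hc : Summable c)
    (hb : ∀ i v, 0 < v → ‖f i v‖ ≤ c i * Real.exp (3 / 2 * v)) :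
    ContinuousOn (fun v => ∑' i, f i v) (Ioi 0) := by
  have hc0 : ∀ i, 0 ≤ c i := fun i => by
    have := (norm_nonneg _).trans (hb i 1 one_pos)
    exact nonneg_of_mul_nonneg_left this (Real.exp_pos _)
  intro v hv
  have h1 : ContinuousOn (fun v => ∑' i, f i v) (Ioo 0 (v + 1)) := by
    refine continuousOn_tsum (u := fun i => c i * Real.exp (3 / 2 * (v + 1)))
      (fun i => (hf i).continuousOn) (hc.mul_right _) fun i y hy => ?_
    refine (hb i y hy.1).trans (mul_le_mul_of_nonneg_left ?_ (hc0 i))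
    exact Real.exp_le_exp.2 (by linarith [hy.2])
  exact (h1.continuousAt (Ioo_mem_nhds hv (by linarith))).continuousWithinAt

theorem integrableOn_exp_mul_of_norm_le_mul_exp {g : ℝ → ℂ} {K : ℝ}
    (hg : ContinuousOn g (Ioi 0)) (hb : ∀ v, 0 < v → ‖g v‖ ≤ K * Real.exp (3 / 2 * v)) {w : ℂ}
    (hw : w.re = 2) : IntegrableOn (fun v : ℝ => exp (-w * v) * g v) (Ioi 0) := by
  have h1 : IntegrableOn (fun v : ℝ => K * Real.exp (-(1 / 2) * v)) (Ioi 0) :=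
    (integrableOn_exp_mul_Ioi (by norm_num) 0).const_mul K
  refine Integrable.mono' h1 ?_ ?_
  · refine ContinuousOn.aestronglyMeasurable ?_ measurableSet_Ioi
    exact (by fun_prop : Continuous fun v : ℝ => exp (-w * v)).continuousOn.mul hg
  · refine (ae_restrict_iff' measurableSet_Ioi).2 (Eventually.of_forall fun v hv => ?_)
    rw [norm_mul, norm_exp]
    have h2 : (-w * v).re = -2 * v := by simp [hw]
    rw [h2]
    calc Real.exp (-2 * v) * ‖g v‖ ≤ Real.exp (-2 * v) * (K * Real.exp (3 / 2 * v)) :=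
          mul_le_mul_of_nonneg_left (hb v hv) (Real.exp_pos _).le
      _ = K * (Real.exp (-2 * v) * Real.exp (3 / 2 * v)) := by ring
      _ = _ := by
        rw [← Real.exp_add]
        congr 2
        ring

theorem norm_tsum_le_mul_exp (hc : Summable c)
    (hb : ∀ i v, 0 < v → ‖f i v‖ ≤ c i * Real.exp (3 / 2 * v)) {v : ℝ} (hv : 0 < v) :
    ‖∑' i, f i v‖ ≤ (∑' i, c i) * Real.exp (3 / 2 * v) :=
  tsum_of_norm_bounded (hc.hasSum.mul_right _) fun i => hb i v hv

theorem hasSum_laplace [Countable ι] (hf : ∀ i, Continuous (f i)) (hc : Summable c)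
    (hb : ∀ i v, 0 < v → ‖f i v‖ ≤ c i * Real.exp (3 / 2 * v)) {w : ℂ} (hw : w.re = 2) :
    HasSum (fun i => ∫ v in Ioi (0 : ℝ), exp (-w * v) * f i v)
      (∫ v in Ioi (0 : ℝ), exp (-w * v) * ∑' i, f i v) := by
  have hre : ∀ v : ℝ, (-w * v).re = -2 * v := fun v => by simp [hw]
  refine hasSum_integral_of_dominated_convergence
    (fun i (v : ℝ) => c i * Real.exp (-(1 / 2) * v)) ?_ ?_ ?_ ?_ ?_
  · intro i
    exact Continuous.aestronglyMeasurable
      ((by fun_prop : Continuous fun v : ℝ => exp (-w * v)).mul (hf i))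
  · intro i
    refine (ae_restrict_iff' measurableSet_Ioi).2 (Eventually.of_forall fun v hv => ?_)
    rw [norm_mul, norm_exp, hre]
    calc Real.exp (-2 * v) * ‖f i v‖ ≤ Real.exp (-2 * v) * (c i * Real.exp (3 / 2 * v)) :=
          mul_le_mul_of_nonneg_left (hb i v hv) (Real.exp_pos _).le
      _ = c i * (Real.exp (-2 * v) * Real.exp (3 / 2 * v)) := by ring
      _ = _ := by
        rw [← Real.exp_add]
        congr 2
        ring
  · exact Eventually.of_forall fun v => hc.mul_right _
  · simp_rw [tsum_mul_right]
    exact (integrableOn_exp_mul_Ioi (by norm_num) 0).const_mul _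
  · refine (ae_restrict_iff' measurableSet_Ioi).2 (Eventually.of_forall fun v hv => ?_)
    exact (summable_of_norm_le_mul_exp hc hb hv).hasSum.mul_left _

end LaplaceSeries

theorem integral_exp_mul_exp {w u : ℂ} (h : u.re < w.re) :
    ∫ v in Ioi (0 : ℝ), exp (-w * v) * exp (v * u) = 1 / (w - u) := by
  have h1 : ∀ v : ℝ, exp (-w * v) * exp (v * u) = exp ((u - w) * v) := fun v => by
    rw [← exp_add]
    congr 1
    ring
  simp_rw [h1]
  rw [integral_exp_mul_complex_Ioi (by simpa using h)]
  have h2 : w - u ≠ 0 := fun h' => by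
    have := congrArg re h'
    simp at this
    linarith
  have h3 : u - w ≠ 0 := fun h' => h2 (by rw [← neg_sub, h', neg_zero])
  simp
  field_simp
  ring

theorem integral_exp_mul_max {w : ℂ} (hw : w.re = 2) {b : ℝ} (hb : 0 ≤ b) :
    ∫ v in Ioi (0 : ℝ), exp (-w * v) * ((max (v - b) 0 : ℝ) : ℂ) = exp (-w * b) / w ^ 2 := by
  have hw0 : w ≠ 0 := by rintro rfl; norm_num at hw
  have h1 : ∫ v in Ioi (0 : ℝ), exp (-w * v) * ((max (v - b) 0 : ℝ) : ℂ) =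
      ∫ v in Ioi b, exp (-w * v) * ((v - b : ℝ) : ℂ) := by
    rw [setIntegral_eq_of_subset_of_forall_sdiff_eq_zero measurableSet_Ioi (Ioi_subset_Ioi hb)]
    · refine setIntegral_congr_fun measurableSet_Ioi fun v hv => ?_
      have : 0 ≤ v - b := sub_nonneg.2 (le_of_lt hv)
      simp only [max_eq_left this]
    · intro v hv
      have : v - b ≤ 0 := sub_nonpos.2 (not_lt.1 hv.2)
      simp [max_eq_right this]
  rw [h1]
  have hint : IntegrableOn (fun v : ℝ => exp (-w * v) * ((v - b : ℝ) : ℂ)) (Ioi b) := by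
    refine Integrable.mono' ((integrableOn_exp_mul_Ioi (a := -1) (by norm_num) b)) 
      (Continuous.aestronglyMeasurable (by fun_prop)) ?_
    refine (ae_restrict_iff' measurableSet_Ioi).2 (Eventually.of_forall fun v hv => ?_)
    have hv' : 0 ≤ v - b := sub_nonneg.2 (le_of_lt hv)
    have h2 : (-w * v).re = -2 * v := by simp [hw]
    rw [norm_mul, norm_exp, h2, norm_real, Real.norm_of_nonneg hv']
    have h3 : v - b ≤ Real.exp v := by linarith [Real.add_one_le_exp v]
    calc Real.exp (-2 * v) * (v - b) ≤ Real.exp (-2 * v) * Real.exp v := by gcongr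
      _ = _ := by
        rw [← Real.exp_add]
        congr 1
        ring
  have hlim : Tendsto (fun v : ℝ => -(((v - b : ℝ) : ℂ) / w + 1 / w ^ 2) * exp (-w * v)) atTop
      (𝓝 0) := by
    rw [tendsto_zero_iff_norm_tendsto_zero]
    have h3 : Tendsto (fun v : ℝ => (v ^ 1 * Real.exp (-v)) * (1 / ‖w‖) +
        (|b| / ‖w‖ + 1 / ‖w‖ ^ 2) * (v ^ 0 * Real.exp (-v))) atTop (𝓝 (0 * (1 / ‖w‖) +
        (|b| / ‖w‖ + 1 / ‖w‖ ^ 2) * 0)) :=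
      ((Real.tendsto_pow_mul_exp_neg_atTop_nhds_zero 1).mul_const _).add
        ((Real.tendsto_pow_mul_exp_neg_atTop_nhds_zero 0).const_mul _)
    simp only [zero_mul, mul_zero, add_zero] at h3
    refine squeeze_zero' (Eventually.of_forall fun v => norm_nonneg _) ?_ h3
    filter_upwards [eventually_ge_atTop 0] with v hv
    have h2 : (-w * v).re = -2 * v := by simp [hw]
    rw [norm_mul, norm_exp, h2, norm_neg]
    have h4 : Real.exp (-2 * v) ≤ Real.exp (-v) := Real.exp_le_exp.2 (by linarith)
    have h5 : ‖((v - b : ℝ) : ℂ) / w + 1 / w ^ 2‖ ≤ (v + |b|) / ‖w‖ + 1 / ‖w‖ ^ 2 := by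
      refine (norm_add_le _ _).trans ?_
      rw [norm_div, norm_div, norm_real, norm_one, norm_pow]
      gcongr
      refine (norm_sub_le _ _).trans ?_
      rw [Real.norm_of_nonneg hv, Real.norm_eq_abs]
    calc _ ≤ ((v + |b|) / ‖w‖ + 1 / ‖w‖ ^ 2) * Real.exp (-v) :=
          mul_le_mul h5 h4 (Real.exp_pos _).le ((norm_nonneg _).trans h5)
      _ = _ := by ring
  have hder : ∀ v ∈ Ici b, HasDerivAt
      (fun v : ℝ => -(((v - b : ℝ) : ℂ) / w + 1 / w ^ 2) * exp (-w * v))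
      (exp (-w * v) * ((v - b : ℝ) : ℂ)) v := by
    intro v _
    have h3 : HasDerivAt (fun v : ℝ => exp (-w * v)) (exp (-w * v) * (-w * 1)) v :=
      ((hasDerivAt_id (v : ℂ)).const_mul (-w)).cexp.comp_ofReal
    have h4 : HasDerivAt (fun v : ℝ => -(((v - b : ℝ) : ℂ) / w + 1 / w ^ 2)) (-(1 / w)) v := by
      have h5 : HasDerivAt (fun v : ℝ => ((v - b : ℝ) : ℂ)) ((1 : ℝ) : ℂ) v :=
        ((hasDerivAt_id v).sub_const b).ofReal_comp
      have h6 := ((h5.div_const w).add_const (1 / w ^ 2)).neg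
      rw [ofReal_one] at h6
      exact h6
    refine (h4.mul h3).congr_deriv ?_
    field_simp
    ring
  rw [integral_Ioi_of_hasDerivAt_of_tendsto' hder hint hlim]
  simp
  field_simp

theorem integral_exp_mul_linear {w : ℂ} (hw : w.re = 2) (A B : ℂ) :
    ∫ v in Ioi (0 : ℝ), exp (-w * v) * (A * v + B) = A / w ^ 2 + B / w := by
  have h1 : ∀ v ∈ Ioi (0 : ℝ), exp (-w * v) * (A * v + B) =
      A * (exp (-w * v) * ((max (v - 0) 0 : ℝ) : ℂ)) + B * (exp (-w * v) * exp (v * 0)) := by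
    intro v hv
    have : max (v - 0) 0 = v := by rw [sub_zero]; exact max_eq_left (le_of_lt hv)
    rw [this, mul_zero, exp_zero]
    ring
  rw [setIntegral_congr_fun measurableSet_Ioi h1, integral_add, integral_const_mul,
    integral_const_mul, integral_exp_mul_max hw le_rfl, integral_exp_mul_exp (by simp [hw])]
  · simp
    ring
  · refine (integrableOn_exp_mul_of_norm_le_mul_exp (K := 1) (Continuous.continuousOn
      (by fun_prop)) (fun v hv => ?_) hw).const_mul A
    rw [sub_zero, max_eq_left hv.le, norm_real, Real.norm_of_nonneg hv.le, one_mul]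
    linarith [Real.add_one_le_exp (3 / 2 * v)]
  · refine (integrableOn_exp_mul_of_norm_le_mul_exp (K := 1) (Continuous.continuousOn
      (by fun_prop)) (fun v hv => ?_) hw).const_mul B
    rw [mul_zero, exp_zero, norm_one, one_mul]
    exact Real.one_le_exp (by linarith)

end Laplace

/-! ### From partial fractions to an identity in v. -/

section Kernel

open Complex Metric Set Filter Topology MeasureTheory
open scoped FourierTransform

theorem max_sub_log_le {v : ℝ} {n : ℕ} (hn : n ≠ 0) :
    max (v - Real.log n) 0 ≤ (n : ℝ) ^ (-(3 / 2) : ℝ) * Real.exp (3 / 2 * v) := by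
  have hn' : (0 : ℝ) < n := by positivity
  have h1 : (n : ℝ) ^ (-(3 / 2) : ℝ) * Real.exp (3 / 2 * v) =
      Real.exp (3 / 2 * (v - Real.log n)) := by
    rw [Real.rpow_def_of_pos hn', ← Real.exp_add]
    congr 1
    ring
  rw [h1]
  refine max_le ?_ (Real.exp_pos _).le
  rcases le_total 0 (v - Real.log n) with h | h
  · linarith [Real.add_one_le_exp (3 / 2 * (v - Real.log n))]
  · exact h.trans (Real.exp_pos _).le

/-- This does the work of Perron's formula. Under the Laplace transform (v - log n)₊ becomes
n^{-w}/w², e^{vu} becomes 1/(w - u), and Av + B becomes A/w² + B/w. The hypothesis equates the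
transforms of two continuous functions on Re w = 2, so the functions agree. -/
theorem sum_mul_sub_log_eq_of_laplace {ι : Type*} [Countable ι] {m u : ι → ℂ}
    (hu : ∀ i, (u i).re ≤ 1) (hm : Summable fun i => ‖m i‖ / ‖u i‖ ^ 2) {b : ℕ → ℂ}
    (hb : Summable fun n : ℕ => ‖b n‖ * (n : ℝ) ^ (-(3 / 2) : ℝ)) (hb0 : b 0 = 0) {A B : ℂ}
    (h : ∀ w : ℂ, w.re = 2 → (∑' n, b n * (n : ℂ) ^ (-w)) / w ^ 2 =
      A / w ^ 2 + B / w - ∑' i, m i / (u i ^ 2 * (w - u i))) {v : ℝ} (hv : 0 < v) :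
    ∑ n ∈ Finset.Icc 1 ⌊Real.exp v⌋₊, b n * ((v - Real.log n : ℝ) : ℂ) =
      A * v + B - ∑' i, m i / u i ^ 2 * exp (v * u i) := by
  set f : ℕ → ℝ → ℂ := fun n v => b n * ((max (v - Real.log n) 0 : ℝ) : ℂ) with hf
  set g : ι → ℝ → ℂ := fun i v => m i / u i ^ 2 * exp (v * u i) with hg
  have hfc : ∀ n, Continuous (f n) := fun n => by
    simp only [hf]
    fun_prop
  have hgc : ∀ i, Continuous (g i) := fun i => by
    simp only [hg]
    fun_prop
  have hfb : ∀ n v, 0 < v →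
      ‖f n v‖ ≤ ‖b n‖ * (n : ℝ) ^ (-(3 / 2) : ℝ) * Real.exp (3 / 2 * v) := by
    intro n v hv
    rcases eq_or_ne n 0 with rfl | hn
    · simp [hf, hb0]
    · simp only [hf]
      rw [norm_mul, norm_real, Real.norm_of_nonneg (le_max_right _ _), mul_assoc]
      exact mul_le_mul_of_nonneg_left (max_sub_log_le hn) (norm_nonneg _)
  have hgb : ∀ i v, 0 < v → ‖g i v‖ ≤ ‖m i‖ / ‖u i‖ ^ 2 * Real.exp (3 / 2 * v) := by
    intro i v hv
    simp only [hg]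
    rw [norm_mul, norm_div, norm_pow, norm_exp]
    gcongr
    simp only [mul_re, ofReal_re, ofReal_im, zero_mul, sub_zero]
    nlinarith [hu i]
  have hlinb : ∀ v : ℝ, 0 < v → ‖A * v + B‖ ≤ (‖A‖ + ‖B‖) * Real.exp (3 / 2 * v) := by
    intro v hv
    refine (norm_add_le _ _).trans ?_
    rw [norm_mul, norm_real, Real.norm_of_nonneg hv.le, add_mul]
    have h1 := Real.add_one_le_exp (3 / 2 * v)
    have h2 : v ≤ Real.exp (3 / 2 * v) := by linarith
    have h3 : 1 ≤ Real.exp (3 / 2 * v) := by linarith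
    have h4 := mul_le_mul_of_nonneg_left h2 (norm_nonneg A)
    have h5 := mul_le_mul_of_nonneg_left h3 (norm_nonneg B)
    linarith
  have hF := continuousOn_tsum_of_norm_le_mul_exp hfc hb hfb
  have hG := continuousOn_tsum_of_norm_le_mul_exp hgc hm hgb
  have hL : ContinuousOn (fun v : ℝ => A * v + B) (Ioi 0) := Continuous.continuousOn (by fun_prop)
  have hFi := fun (w : ℂ) (hw : w.re = 2) => integrableOn_exp_mul_of_norm_le_mul_exp hF
    (fun v hv => norm_tsum_le_mul_exp hb hfb hv) hw
  have hGi := fun (w : ℂ) (hw : w.re = 2) => integrableOn_exp_mul_of_norm_le_mul_exp hG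
    (fun v hv => norm_tsum_le_mul_exp hm hgb hv) hw
  have hLi := fun (w : ℂ) (hw : w.re = 2) => integrableOn_exp_mul_of_norm_le_mul_exp hL hlinb hw
  have hsplit : ∀ w : ℂ, (fun v : ℝ => exp (-w * v) *
      (∑' n, f n v + ∑' i, g i v - (A * v + B))) = fun v : ℝ => exp (-w * v) * ∑' n, f n v +
        exp (-w * v) * ∑' i, g i v - exp (-w * v) * (A * v + B) := by
    intro w
    ext v
    ring
  have key := eq_zero_of_laplace_eq_zero (c := 2) (φ := fun v : ℝ => ∑' n, f n v + ∑' i, g i v -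
      (A * v + B)) ((hF.add hG).sub hL) ?_ ?_ hv
  · have hfin : ∑' n, f n v = ∑ n ∈ Finset.Icc 1 ⌊Real.exp v⌋₊,
        b n * ((v - Real.log n : ℝ) : ℂ) := by
      rw [tsum_eq_sum (s := Finset.Icc 1 ⌊Real.exp v⌋₊)]
      · refine Finset.sum_congr rfl fun n hn => ?_
        rw [Finset.mem_Icc] at hn
        have hn0 : (0 : ℝ) < n := by exact_mod_cast hn.1
        have h1 : (n : ℝ) ≤ Real.exp v := (Nat.le_floor_iff (Real.exp_pos v).le).1 hn.2
        have h2 : Real.log n ≤ v := (Real.log_le_iff_le_exp hn0).2 h1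
        simp only [hf]
        rw [max_eq_left (by linarith)]
      · intro n hn
        rcases Nat.eq_zero_or_pos n with rfl | hn0
        · simp [hf, hb0]
        · have h1 : ¬ n ≤ ⌊Real.exp v⌋₊ := fun h => hn (Finset.mem_Icc.2 ⟨hn0, h⟩)
          rw [Nat.le_floor_iff (Real.exp_pos v).le, not_le] at h1
          have h2 : v ≤ Real.log n := by
            rw [Real.le_log_iff_exp_le (by positivity)]
            exact h1.le
          simp only [hf]
          rw [max_eq_right (by linarith)]
          simp
    rw [← hfin]
    linear_combination key
  · have h1 := ((hFi (2 : ℝ) (by simp)).add (hGi (2 : ℝ) (by simp))).sub (hLi (2 : ℝ) (by simp))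
    rw [hsplit]
    exact h1
  · intro w hw
    have hFG : Integrable (fun v : ℝ => exp (-w * v) * ∑' n, f n v + exp (-w * v) * ∑' i, g i v)
        (volume.restrict (Ioi 0)) := (hFi w hw).add (hGi w hw)
    rw [hsplit, integral_sub hFG (hLi w hw),
      integral_add (hFi w hw) (hGi w hw), integral_exp_mul_linear hw,
      ← (hasSum_laplace hfc hb hfb hw).tsum_eq, ← (hasSum_laplace hgc hm hgb hw).tsum_eq]
    have e1 : ∀ n : ℕ, ∫ v in Ioi (0 : ℝ), exp (-w * v) * f n v =
        b n * (n : ℂ) ^ (-w) / w ^ 2 := by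
      intro n
      rcases eq_or_ne n 0 with rfl | hn
      · simp [hf, hb0]
      · simp only [hf]
        have h1 : ∀ v : ℝ, exp (-w * v) * (b n * ((max (v - Real.log n) 0 : ℝ) : ℂ)) =
            b n * (exp (-w * v) * ((max (v - Real.log n) 0 : ℝ) : ℂ)) := fun v => by ring
        simp_rw [h1]
        rw [integral_const_mul, integral_exp_mul_max hw
          (Real.log_nonneg (by exact_mod_cast Nat.one_le_iff_ne_zero.2 hn)),
          cpow_def_of_ne_zero (Nat.cast_ne_zero.2 hn), ← natCast_log, mul_comm (-w), mul_div_assoc]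
    have e2 : ∀ i, ∫ v in Ioi (0 : ℝ), exp (-w * v) * g i v =
        m i / (u i ^ 2 * (w - u i)) := by
      intro i
      simp only [hg]
      have h1 : ∀ v : ℝ, exp (-w * v) * (m i / u i ^ 2 * exp (v * u i)) =
          m i / u i ^ 2 * (exp (-w * v) * exp (v * u i)) := fun v => by ring
      simp_rw [h1]
      rw [integral_const_mul, integral_exp_mul_exp (by rw [hw]; linarith [hu i])]
      rw [div_mul_div_comm, mul_one]
    simp_rw [e1, e2]
    rw [tsum_div_const, h w hw]
    ring

/-- Partial fractions for differences of `D` yield partial fractions for the derivative. -/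
theorem deriv_eq_neg_tsum {ι : Type*} {m u : ι → ℂ} (hm : Summable fun i => ‖m i‖ / ‖u i‖ ^ 2)
    {δ : ℝ} (hδ : 0 < δ) (hu : ∀ i, δ ≤ ‖u i‖) {D : ℂ → ℂ} {s : ℂ} (hD : DifferentiableAt ℂ D s)
    (h : ∀ w : ℝ, 0 < w → HasSum (fun i => m i / (w - u i) + m i / u i) (D (s + w) - D s)) :
    deriv D s = - ∑' i, m i / u i ^ 2 := by
  have hu0 : ∀ i, u i ≠ 0 := fun i => norm_pos_iff.1 (hδ.trans_le (hu i))
  have h1 : HasDerivAt (fun r : ℝ => D (s + r)) (deriv D s) 0 := by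
    have h2 : HasDerivAt D (deriv D s) (s + (0 : ℝ)) := by simpa using hD.hasDerivAt
    have h3 : HasDerivAt (fun r : ℂ => D (s + r)) (deriv D s) ((0 : ℝ) : ℂ) :=
      h2.comp_const_add s _
    exact h3.comp_ofReal
  have h4 := (hasDerivAt_iff_tendsto_slope_zero.1 h1).mono_left
    (nhdsWithin_mono 0 (fun x (hx : x ∈ Ioi (0 : ℝ)) => (ne_of_gt hx : x ≠ 0)))
  -- (1/w)(1/(w - u) + 1/u) = 1/(u(w - u)), so these are the terms of the right-hand difference
  -- quotient. For w < δ/2 they are at most twice ‖m‖/‖u‖².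
  have h5 : Tendsto (fun w : ℝ => ∑' i, m i / (u i * (w - u i))) (𝓝[>] 0)
      (𝓝 (∑' i, m i / (u i * (0 - u i)))) := by
    refine tendsto_tsum_of_dominated_convergence (hm.mul_left 2) (fun i => ?_) ?_
    · have : ContinuousAt (fun w : ℝ => m i / (u i * (w - u i))) 0 := by
        refine ContinuousAt.div (by fun_prop) (by fun_prop) ?_
        simp [hu0 i]
      simpa using this.tendsto.mono_left nhdsWithin_le_nhds
    · filter_upwards [Ioo_mem_nhdsGT (half_pos hδ)] with w hw i
      have h6 : ‖u i‖ / 2 ≤ ‖(w : ℂ) - u i‖ := by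
        have := norm_sub_norm_le (u i) w
        rw [norm_sub_rev, norm_real, Real.norm_of_nonneg hw.1.le] at this
        linarith [hu i, hw.2]
      have h7 : 0 < ‖u i‖ := hδ.trans_le (hu i)
      rw [norm_div, norm_mul]
      calc ‖m i‖ / (‖u i‖ * ‖(w : ℂ) - u i‖) ≤ ‖m i‖ / (‖u i‖ * (‖u i‖ / 2)) := by gcongr
        _ = _ := by field_simp
  have h8 : deriv D s = ∑' i, m i / (u i * (0 - u i)) := by
    refine tendsto_nhds_unique h4 (h5.congr' ?_)
    filter_upwards [Ioo_mem_nhdsGT hδ] with w hw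
    have hw0 : (w : ℂ) ≠ 0 := ofReal_ne_zero.2 hw.1.ne'
    simp only [zero_add, ofReal_zero, add_zero]
    rw [← (h w hw.1).tsum_eq, real_smul, ← tsum_mul_left]
    refine tsum_congr fun i => ?_
    have h9 : (w : ℂ) - u i ≠ 0 := fun h' => by
      have : ‖u i‖ = w := by
        rw [← sub_eq_zero.1 h', norm_real, Real.norm_of_nonneg hw.1.le]
      linarith [hu i, hw.2]
    have := hu0 i
    push_cast
    field_simp
    ring
  rw [h8, ← tsum_neg]
  refine tsum_congr fun i => ?_
  have := hu0 i
  field_simp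
  ring

end Kernel

/-! ### The explicit formula for ζ'/ζ. -/

section Explicit

open Complex Metric Set Filter Topology MeasureTheory

theorem logDeriv_Gammaℝ {s : ℂ} (hs : 0 < s.re) :
    DifferentiableAt ℂ Gammaℝ s ∧
    logDeriv Gammaℝ s = -(Real.log Real.pi : ℂ) / 2 + digamma (s / 2) / 2 := by
  have hpi : (Real.pi : ℂ) ≠ 0 := ofReal_ne_zero.2 Real.pi_ne_zero
  have h2 : HasDerivAt (fun s : ℂ => s / 2) (1 / 2) s := (hasDerivAt_id s).div_const 2
  have h1 : HasDerivAt (fun s : ℂ => (Real.pi : ℂ) ^ (-s / 2))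
      ((Real.pi : ℂ) ^ (-s / 2) * Complex.log Real.pi * (-1 / 2)) s :=
    ((hasDerivAt_id s).neg.div_const 2).const_cpow (Or.inl hpi)
  have hre : 0 < (s / 2).re := by simpa using hs
  have hd : DifferentiableAt ℂ Gamma (s / 2) := by
    refine differentiableAt_Gamma _ fun m h => ?_
    rw [h] at hre
    simp at hre
    linarith [m.cast_nonneg (α := ℝ)]
  have h3 : HasDerivAt (fun s : ℂ => Gamma (s / 2)) (deriv Gamma (s / 2) * (1 / 2)) s :=
    hd.hasDerivAt.comp s h2
  have hG : Gamma (s / 2) ≠ 0 := Gamma_ne_zero_of_re_pos hre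
  have hP : (Real.pi : ℂ) ^ (-s / 2) ≠ 0 := by simp [cpow_eq_zero_iff, hpi]
  have hdef : Gammaℝ = fun s : ℂ => (Real.pi : ℂ) ^ (-s / 2) * Gamma (s / 2) := by
    ext s
    exact Gammaℝ_def s
  rw [hdef]
  refine ⟨h1.differentiableAt.mul h3.differentiableAt, ?_⟩
  rw [logDeriv_mul s hP hG h1.differentiableAt h3.differentiableAt, logDeriv_apply, logDeriv_apply,
    h1.deriv, h3.deriv, digamma_def, logDeriv_apply, ofReal_log Real.pi_pos.le]
  field_simp

/-- Shifting the argument of digamma to s/2 + 1 absorbs the 1/s from the factor s; the poles left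
are exactly the trivial zeros. -/
theorem logDeriv_riemannZeta_eq {s : ℂ} (hs : 0 < s.re) (h1 : s ≠ 1) (hζ : riemannZeta s ≠ 0) :
    logDeriv riemannZeta s = logDeriv riemannXi s - 1 / (s - 1) + (Real.log Real.pi : ℂ) / 2
      - digamma (s / 2 + 1) / 2 := by
  have h0 : s ≠ 0 := by rintro rfl; simp at hs
  have h1' : 1 - s ≠ 0 := sub_ne_zero.2 h1.symm
  have h1'' : s - 1 ≠ 0 := sub_ne_zero.2 h1
  have hG := Gammaℝ_ne_zero_of_re_pos hs
  have hGd := logDeriv_Gammaℝ hs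
  have hζd := differentiableAt_riemannZeta h1
  have heq : riemannXi =ᶠ[𝓝 s] fun s => (s * (1 - s)) * (Gammaℝ s * riemannZeta s) := by
    filter_upwards [(isOpen_lt continuous_const continuous_re).mem_nhds hs,
      isOpen_ne.mem_nhds h1] with z hz hz1
    exact riemannXi_eq_mul_riemannZeta hz hz1
  have hq : HasDerivAt (fun s : ℂ => s * (1 - s)) (1 * (1 - s) + s * (-1)) s :=
    (hasDerivAt_id s).mul ((hasDerivAt_id s).const_sub 1)
  have hX : logDeriv riemannXi s = logDeriv (fun s => (s * (1 - s)) *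
      (Gammaℝ s * riemannZeta s)) s := by
    rw [logDeriv_apply, logDeriv_apply, heq.deriv_eq, heq.self_of_nhds]
  have hre : 0 < (s / 2).re := by simpa using hs
  rw [hX, logDeriv_mul (f := fun s => s * (1 - s)) (g := fun s => Gammaℝ s * riemannZeta s) s
      (mul_ne_zero h0 h1') (mul_ne_zero hG hζ) hq.differentiableAt (hGd.1.mul hζd), logDeriv_mul s hG hζ hGd.1 hζd, hGd.2,
    logDeriv_apply (fun s => s * (1 - s)), hq.deriv,
    digamma_apply_add_one]
  · field_simp
    ring
  · intro m h
    rw [h] at hre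
    simp at hre
    linarith [m.cast_nonneg (α := ℝ)]

/-- Index set for the zeros (nontrivial, trivial) and the pole of the zeta function. -/
abbrev ZetaIndex : Type := ({ρ : ℂ // analyticOrderNatAt riemannXi ρ ≠ 0} ⊕ ℕ) ⊕ Unit

/-- Order of the zeta function at an indexed zero or pole. -/
noncomputable def zetaOrder : ZetaIndex → ℂ :=
  Sum.elim (Sum.elim (fun ρ => (analyticOrderNatAt riemannXi ρ : ℂ)) fun _ => 1) fun _ => -1

/-- Location of an indexed zero or pole. -/
noncomputable def zetaPoint : ZetaIndex → ℂ :=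
  Sum.elim (Sum.elim (fun ρ => (ρ : ℂ)) fun k : ℕ => -(2 * (k + 1))) fun _ => 1

theorem hasSum_trivial_zeros {s : ℂ} (hs : 1 / 2 < s.re) :
    ∃ S ≤ 1, HasSum (fun k : ℕ => 1 / ‖-(2 * ((k : ℂ) + 1)) - s‖ ^ 2) S := by
  have hz2 : HasSum (fun k : ℕ => 1 / 4 * (1 / ((k : ℝ) + 1) ^ 2)) (1 / 4 * (Real.pi ^ 2 / 6)) := by
    have := (hasSum_nat_add_iff' 1).2 hasSum_zeta_two
    have h0 : HasSum (fun k : ℕ => 1 / ((k : ℝ) + 1) ^ 2) (Real.pi ^ 2 / 6) := by simpa using this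
    exact h0.mul_left (1 / 4)
  have hle : ∀ k : ℕ, 1 / ‖-(2 * ((k : ℂ) + 1)) - s‖ ^ 2 ≤ 1 / 4 * (1 / ((k : ℝ) + 1) ^ 2) := by
    intro k
    have h1 : 2 * ((k : ℝ) + 1) ≤ ‖-(2 * ((k : ℂ) + 1)) - s‖ := by
      rw [← norm_neg]
      refine le_trans ?_ (re_le_norm _)
      simp
      linarith
    calc 1 / ‖-(2 * ((k : ℂ) + 1)) - s‖ ^ 2 ≤ 1 / (2 * ((k : ℝ) + 1)) ^ 2 := by gcongr
      _ = _ := by field_simp; norm_num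
  have hsum := Summable.of_nonneg_of_le (fun _ => by positivity) hle hz2.summable
  refine ⟨_, ?_, hsum.hasSum⟩
  refine (hasSum_le hle hsum.hasSum hz2).trans ?_
  have := Real.pi_lt_four
  nlinarith [Real.pi_pos]

namespace RiemannHypothesis

theorem riemannZeta_ne_zero (hRH : RiemannHypothesis) {s : ℂ} (hs : 1 / 2 < s.re) : riemannZeta s ≠ 0 := fun h => by
  have := hRH.re_eq_of_riemannZeta_eq_zero (by linarith) h
  linarith

theorem re_coe_eq (hRH : RiemannHypothesis) (ρ : {ρ : ℂ // analyticOrderNatAt riemannXi ρ ≠ 0}) : (ρ : ℂ).re = 1 / 2 :=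
  hRH.re_eq_of_riemannXi_eq_zero (apply_eq_zero_of_analyticOrderNatAt_ne_zero ρ.2)

theorem hasSum_zeros (hRH : RiemannHypothesis) {s : ℂ} (hs : 1 / 2 < s.re) :
    HasSum (fun ρ : {ρ : ℂ // analyticOrderNatAt riemannXi ρ ≠ 0} =>
      (analyticOrderNatAt riemannXi ρ : ℝ) / ‖s - ρ‖ ^ 2)
      ((logDeriv riemannXi s).re / (s.re - 1 / 2)) := by
  have h := hRH.hasSum_logDeriv_riemannXi.1 s hs
  refine (hasSum_subtype_iff_of_support_subset (s := {ρ | analyticOrderNatAt riemannXi ρ ≠ 0})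
    fun ρ hρ => ?_).2 h
  intro h'
  simp [h'] at hρ

theorem countable_zetaIndex (hRH : RiemannHypothesis) : Countable ZetaIndex := by
  have h : Countable {ρ : ℂ // analyticOrderNatAt riemannXi ρ ≠ 0} := by
    have h1 := (hRH.hasSum_logDeriv_riemannXi.1 1 (by norm_num)).summable.countable_support
    refine (h1.mono fun ρ hρ => ?_).to_subtype
    refine div_ne_zero (Nat.cast_ne_zero.2 hρ) (pow_ne_zero _ (norm_ne_zero_iff.2 ?_))
    rw [sub_ne_zero]
    rintro rfl
    have := hRH.re_coe_eq ⟨1, hρ⟩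
    norm_num at this
  infer_instance

/-- The nontrivial zeros come from ξ, the trivial ones from digamma, and the pole from 1/(s - 1).
Taking differences cancels the constants and makes the sums absolutely convergent. -/
theorem hasSum_zetaIndex_sub (hRH : RiemannHypothesis) {s s' : ℂ} (hs : 1 / 2 < s.re) (hs1 : s ≠ 1) (hs' : 1 / 2 < s'.re)
    (hs1' : s' ≠ 1) :
    HasSum (fun i => zetaOrder i / (s - zetaPoint i) - zetaOrder i / (s' - zetaPoint i))
      (logDeriv riemannZeta s - logDeriv riemannZeta s') := by
  have e : logDeriv riemannZeta s - logDeriv riemannZeta s' =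
      (logDeriv riemannXi s - logDeriv riemannXi s') +
        (-1 / 2) * (digamma (s / 2 + 1) - digamma (s' / 2 + 1)) +
        (-1 / (s - 1) - -1 / (s' - 1)) := by
    rw [logDeriv_riemannZeta_eq (by linarith) hs1 (hRH.riemannZeta_ne_zero hs),
      logDeriv_riemannZeta_eq (by linarith) hs1' (hRH.riemannZeta_ne_zero hs')]
    ring
  rw [e]
  refine HasSum.sum (HasSum.sum ?_ ?_) ?_
  · refine (hasSum_subtype_iff_of_support_subset (s := {ρ | analyticOrderNatAt riemannXi ρ ≠ 0})
      fun ρ hρ => ?_).2 (hRH.hasSum_logDeriv_riemannXi.2 s s' hs hs')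
    intro h'
    simp [h'] at hρ
  · have hz : ∀ z : ℂ, 1 / 2 < z.re → 0 < (z / 2 + 1).re := fun z hz => by
      simp
      linarith
    refine ((hasSum_digamma_sub (hz s hs) (hz s' hs')).mul_left (-1 / 2)).congr_fun ?_
    intro k
    have h1 := GammaSeq_denominator_ne_zero (hz s hs) k
    have h2 := GammaSeq_denominator_ne_zero (hz s' hs') k
    have h3 : ∀ z : ℂ, z - -(2 * ((k : ℂ) + 1)) = 2 * (z / 2 + 1 + k) := fun z => by ring
    simp only [Function.comp, zetaOrder, zetaPoint, Sum.elim_inl, Sum.elim_inr, h3]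
    field_simp
    ring
  · exact hasSum_unique _

theorem norm_sub_zetaPoint (hRH : RiemannHypothesis) (s : ℂ) (i : ZetaIndex) :
    min (s.re - 1 / 2) ‖s - 1‖ ≤ ‖zetaPoint i - s‖ := by
  rw [norm_sub_rev (zetaPoint i) s]
  rcases i with (ρ | k) | u
  · refine (min_le_left _ _).trans (le_trans ?_ (re_le_norm _))
    simp [zetaPoint, hRH.re_coe_eq ρ]
  · refine (min_le_left _ _).trans (le_trans ?_ (re_le_norm _))
    simp [zetaPoint]
    linarith [k.cast_nonneg (α := ℝ)]
  · exact min_le_right _ _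

theorem re_zetaPoint_le (hRH : RiemannHypothesis) (i : ZetaIndex) : (zetaPoint i).re ≤ 1 := by
  rcases i with (ρ | k) | u
  · have := hRH.re_coe_eq ρ
    simp [zetaPoint, this]
    norm_num
  · simp [zetaPoint]
    linarith [k.cast_nonneg (α := ℝ)]
  · simp [zetaPoint]

theorem summable_zetaIndex (hRH : RiemannHypothesis) {s : ℂ} (hs : 1 / 2 < s.re) :
    Summable fun i => ‖zetaOrder i‖ / ‖zetaPoint i - s‖ ^ 2 := by
  refine Summable.sum _ (Summable.sum _ ?_ ?_) (hasSum_unique _).summable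
  · refine (hRH.hasSum_zeros hs).summable.congr fun ρ => ?_
    simp [zetaOrder, zetaPoint, norm_sub_rev]
  · obtain ⟨S, -, h⟩ := hasSum_trivial_zeros hs
    refine h.summable.congr fun k => ?_
    simp [zetaOrder, zetaPoint]

/-- With v = log x, the Laplace transform of the left side is -(ζ'/ζ)(s + w)/w². Its partial
fractions in w are the transform of the right side. -/
theorem explicit_formula (hRH : RiemannHypothesis) {s : ℂ} (hs : 1 / 2 < s.re) (hs1 : s.im ≠ 0) {v : ℝ} (hv : 0 < v) :
    ∑ n ∈ Finset.Icc 1 ⌊Real.exp v⌋₊, (ArithmeticFunction.vonMangoldt n : ℂ) * (n : ℂ) ^ (-s) *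
        ((v - Real.log n : ℝ) : ℂ) =
      -logDeriv riemannZeta s * v + -deriv (logDeriv riemannZeta) s -
        ∑' i, zetaOrder i / (zetaPoint i - s) ^ 2 * exp (v * (zetaPoint i - s)) := by
  have := hRH.countable_zetaIndex
  have hne1 : s ≠ 1 := by rintro rfl; simp at hs1
  have hδ : 0 < min (s.re - 1 / 2) ‖s - 1‖ :=
    lt_min (by linarith) (norm_pos_iff.2 (sub_ne_zero.2 hne1))
  have hu0 : ∀ i, zetaPoint i - s ≠ 0 := fun i =>
    norm_pos_iff.1 (hδ.trans_le (hRH.norm_sub_zetaPoint s i))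
  have hD : DifferentiableAt ℂ (logDeriv riemannZeta) s := by
    have h1 : AnalyticAt ℂ riemannZeta s := analyticOn_riemannZeta s hne1
    exact h1.deriv.differentiableAt.div h1.differentiableAt (hRH.riemannZeta_ne_zero hs)
  have hdiff : ∀ w : ℂ, 0 ≤ w.re → s + w ≠ 1 →
      HasSum (fun i => zetaOrder i / (w - (zetaPoint i - s)) + zetaOrder i / (zetaPoint i - s))
        (logDeriv riemannZeta (s + w) - logDeriv riemannZeta s) := by
    intro w hw hw1
    have h := hRH.hasSum_zetaIndex_sub (s := s + w) (s' := s) (by simp; linarith) hw1 hs hne1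
    refine h.congr_fun fun i => ?_
    have h1 : s - zetaPoint i = -(zetaPoint i - s) := by ring
    have h2 : s + w - zetaPoint i = w - (zetaPoint i - s) := by ring
    rw [h1, h2, div_neg, sub_neg_eq_add]
  have hderiv := deriv_eq_neg_tsum (hRH.summable_zetaIndex hs) hδ (hRH.norm_sub_zetaPoint s) hD
    (fun w hw => hdiff w (by simpa using hw.le) (fun h => hs1 (by simpa using congrArg im h)))
  refine sum_mul_sub_log_eq_of_laplace (fun i => ?_) (hRH.summable_zetaIndex hs) ?_ (by simp) ?_ hv
  · have := hRH.re_zetaPoint_le i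
    simp
    linarith
  · have h := (ArithmeticFunction.LSeriesSummable_vonMangoldt
      (s := ((s.re + 3 / 2 : ℝ) : ℂ)) (by simp; linarith)).norm
    refine h.congr fun n => ?_
    rcases eq_or_ne n 0 with rfl | hn
    · simp
    · have hn' : (0 : ℝ) < n := by positivity
      rw [LSeries.norm_term_eq, if_neg hn, norm_mul, norm_natCast_cpow_of_pos (by positivity),
        neg_re, ofReal_re, Real.rpow_add hn', Real.rpow_neg hn'.le, Real.rpow_neg hn'.le]
      field_simp
  · intro w hw
    have hw0 : w ≠ 0 := by rintro rfl; norm_num at hw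
    have hsw : 1 < (s + w).re := by simp; linarith
    have hL : ∑' n : ℕ, (ArithmeticFunction.vonMangoldt n : ℂ) * (n : ℂ) ^ (-s) *
        (n : ℂ) ^ (-w) = -logDeriv riemannZeta (s + w) := by
      have := ArithmeticFunction.LSeries_vonMangoldt_eq_deriv_riemannZeta_div hsw
      rw [logDeriv_apply, ← neg_div, ← this, LSeries]
      refine tsum_congr fun n => ?_
      rcases eq_or_ne n 0 with rfl | hn
      · simp
      · rw [LSeries.term_of_ne_zero hn, mul_assoc, ← cpow_add _ _ (Nat.cast_ne_zero.2 hn),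
          div_eq_mul_inv, ← cpow_neg]
        congr 2
        ring
    have h1 := hdiff w (by rw [hw]; norm_num) (fun h => by rw [h] at hsw; norm_num at hsw)
    have hsm : Summable fun i => zetaOrder i / (zetaPoint i - s) ^ 2 :=
      Summable.of_norm (by simpa using hRH.summable_zetaIndex hs)
    have h2 := h1.add (hsm.hasSum.mul_left w)
    -- Subtracting the Taylor part at w = 0 leaves w²/(u²(w - u)), with u the zero or pole minus s.
    -- The linear part is the series for the derivative of ζ'/ζ at s.
    have h3 : ∀ i, zetaOrder i / (w - (zetaPoint i - s)) + zetaOrder i / (zetaPoint i - s) +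
        w * (zetaOrder i / (zetaPoint i - s) ^ 2) =
        w ^ 2 * (zetaOrder i / ((zetaPoint i - s) ^ 2 * (w - (zetaPoint i - s)))) := by
      intro i
      have h4 := hu0 i
      have h5 : w - (zetaPoint i - s) ≠ 0 := by
        intro h
        have h6 := congrArg re h
        have := hRH.re_zetaPoint_le i
        simp [hw] at h6
        linarith
      field_simp
      ring
    simp_rw [h3] at h2
    have h4 := h2.tsum_eq
    rw [tsum_mul_left] at h4
    rw [hL, hderiv, neg_neg]
    have h5 : ∑' i, zetaOrder i / ((zetaPoint i - s) ^ 2 * (w - (zetaPoint i - s))) =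
        (logDeriv riemannZeta (s + w) - logDeriv riemannZeta s +
          w * ∑' i, zetaOrder i / (zetaPoint i - s) ^ 2) / w ^ 2 := by
      rw [← h4]
      field_simp
    rw [h5]
    field_simp
    ring

/-- Each nontrivial zero has |x^{ρ-s}| = x^{1/2-σ}, and their weights sum to F/(σ - 1/2). The
trivial zeros and the pole contribute at most x^{1/2-σ} each. For the pole this is where √x ≤ t² is
needed, as |1 - s|² ≥ t². -/
theorem norm_explicit_formula_le (hRH : RiemannHypothesis) {s : ℂ} (hs : 1 / 2 < s.re) {v : ℝ} (hv : 0 < v)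
    (hvs : Real.exp (v / 2) ≤ s.im ^ 2) :
    ‖∑ n ∈ Finset.Icc 1 ⌊Real.exp v⌋₊, (ArithmeticFunction.vonMangoldt n : ℂ) * (n : ℂ) ^ (-s) *
        ((v - Real.log n : ℝ) : ℂ) + logDeriv riemannZeta s * v + deriv (logDeriv riemannZeta) s‖ ≤
      ((logDeriv riemannXi s).re / (s.re - 1 / 2) + 2) * Real.exp (-v * (s.re - 1 / 2)) := by
  have hs1 : s.im ≠ 0 := by
    intro h
    rw [h] at hvs
    have := Real.exp_pos (v / 2)
    norm_num at hvs
    linarith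
  have e : ∑ n ∈ Finset.Icc 1 ⌊Real.exp v⌋₊, (ArithmeticFunction.vonMangoldt n : ℂ) *
      (n : ℂ) ^ (-s) * ((v - Real.log n : ℝ) : ℂ) + logDeriv riemannZeta s * v +
      deriv (logDeriv riemannZeta) s =
      -∑' i, zetaOrder i / (zetaPoint i - s) ^ 2 * exp (v * (zetaPoint i - s)) := by
    rw [hRH.explicit_formula hs hs1 hv]
    ring
  rw [e, norm_neg]
  obtain ⟨S, hS1, hS⟩ := hasSum_trivial_zeros hs
  set c : ZetaIndex → ℝ := Sum.elim (Sum.elim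
    (fun ρ => (analyticOrderNatAt riemannXi ρ : ℝ) / ‖s - ρ‖ ^ 2)
    (fun k : ℕ => 1 / ‖-(2 * ((k : ℂ) + 1)) - s‖ ^ 2)) (fun _ => 1) with hc
  have hc1 : HasSum (fun i => c (Sum.inr i)) 1 := hasSum_unique fun i => c (Sum.inr i)
  have hc2 : HasSum (fun i => c (Sum.inl i)) ((logDeriv riemannXi s).re / (s.re - 1 / 2) + S) :=
    HasSum.sum (hRH.hasSum_zeros hs) hS
  have h1 : HasSum c ((logDeriv riemannXi s).re / (s.re - 1 / 2) + S + 1) := HasSum.sum hc2 hc1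
  refine (tsum_of_norm_bounded (h1.mul_right (Real.exp (-v * (s.re - 1 / 2)))) fun i => ?_).trans
    (mul_le_mul_of_nonneg_right (by linarith) (Real.exp_pos _).le)
  rw [norm_mul, norm_div, norm_pow, norm_exp]
  have hre : (v * (zetaPoint i - s)).re = v * ((zetaPoint i).re - s.re) := by simp
  rw [hre]
  rcases i with (ρ | k) | u
  · simp only [hc, zetaPoint, zetaOrder, Sum.elim_inl, hRH.re_coe_eq ρ, norm_natCast]
    rw [norm_sub_rev]
    refine mul_le_mul_of_nonneg_left (Real.exp_le_exp.2 (by linarith)) (by positivity)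
  · simp only [hc, zetaPoint, zetaOrder, Sum.elim_inl, Sum.elim_inr, norm_one]
    refine mul_le_mul_of_nonneg_left (Real.exp_le_exp.2 ?_) (by positivity)
    have : (-(2 * ((k : ℂ) + 1))).re ≤ 1 / 2 := by
      simp
      linarith [k.cast_nonneg (α := ℝ)]
    nlinarith
  · simp only [hc, zetaPoint, zetaOrder, Sum.elim_inr, norm_neg, norm_one, one_re, one_mul]
    have h2 : s.im ^ 2 ≤ ‖1 - s‖ ^ 2 := by
      rw [Complex.sq_norm, normSq_apply]
      simp
      nlinarith [mul_self_nonneg (1 - s.re)]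
    have h3 : Real.exp (v * (1 - s.re)) =
        Real.exp (v / 2) * Real.exp (-v * (s.re - 1 / 2)) := by
      rw [← Real.exp_add]
      congr 1
      ring
    rw [h3, ← mul_assoc]
    have h4 : 0 < s.im ^ 2 := (Real.exp_pos _).trans_le hvs
    calc 1 / ‖1 - s‖ ^ 2 * Real.exp (v / 2) * Real.exp (-v * (s.re - 1 / 2))
        ≤ 1 / s.im ^ 2 * s.im ^ 2 * Real.exp (-v * (s.re - 1 / 2)) := by gcongr
      _ = Real.exp (-v * (s.re - 1 / 2)) := by rw [one_div_mul_cancel h4.ne', one_mul]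

end RiemannHypothesis

end Explicit

/-! ### Integrating along horizontal lines. -/

section Main

open Complex Metric Set Filter Topology MeasureTheory

theorem LSeries_tendsto_horizontal {f : ℕ → ℂ} (hf : LSeriesSummable f 2) (t : ℝ) :
    Tendsto (fun σ : ℝ => LSeries f ((σ : ℂ) + t * I)) atTop (𝓝 (f 1)) := by
  have h : Tendsto (fun σ : ℝ => ∑' n, LSeries.term f ((σ : ℂ) + t * I) n) atTop
      (𝓝 (∑' n : ℕ, if n = 1 then f 1 else 0)) := by
    refine tendsto_tsum_of_dominated_convergence hf.norm (fun n => ?_) ?_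
    · rcases eq_or_ne n 0 with rfl | hn0
      · simp
      rcases eq_or_ne n 1 with rfl | hn1
      · simp [LSeries.term_of_ne_zero]
      · rw [if_neg hn1, tendsto_zero_iff_norm_tendsto_zero]
        have hn : (1 : ℝ) < n := by
          have : 1 < n := by omega
          exact_mod_cast this
        have h1 : Tendsto (fun σ : ℝ => ‖f n‖ / (n : ℝ) ^ σ) atTop (𝓝 0) :=
          (tendsto_rpow_atTop_of_base_gt_one _ hn).const_div_atTop _
        refine h1.congr fun σ => ?_
        rw [LSeries.norm_term_eq, if_neg hn0]
        simp
    · filter_upwards [eventually_ge_atTop 2] with σ hσ n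
      exact LSeries.norm_term_le_of_re_le_re f (by simpa using hσ) n
  rw [tsum_ite_eq] at h
  exact h

theorem HasDerivAt.re_comp {u : ℝ → ℂ} {u' : ℂ} {r : ℝ} (h : HasDerivAt u u' r) :
    HasDerivAt (fun y => (u y).re) u'.re r :=
  reCLM.hasFDerivAt.comp_hasDerivAt r h

theorem tendsto_riemannZeta_horizontal (t : ℝ) :
    Tendsto (fun σ : ℝ => riemannZeta ((σ : ℂ) + t * I)) atTop (𝓝 1) := by
  have h := LSeries_tendsto_horizontal ((LSeriesSummable_one_iff (s := 2)).2 (by norm_num)) t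
  refine h.congr' ?_
  filter_upwards [eventually_gt_atTop 1] with σ hσ
  exact LSeries_one_eq_riemannZeta (by simpa using hσ)

theorem tendsto_logDeriv_riemannZeta_horizontal (t : ℝ) :
    Tendsto (fun σ : ℝ => logDeriv riemannZeta ((σ : ℂ) + t * I)) atTop (𝓝 0) := by
  have h := (LSeries_tendsto_horizontal
    (ArithmeticFunction.LSeriesSummable_vonMangoldt (s := 2) (by norm_num)) t).neg
  simp only [ArithmeticFunction.vonMangoldt_apply_one, ofReal_zero, neg_zero] at h
  refine h.congr' ?_
  filter_upwards [eventually_gt_atTop 1] with σ hσ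
  rw [ArithmeticFunction.LSeries_vonMangoldt_eq_deriv_riemannZeta_div (by simpa using hσ),
    logDeriv_apply, neg_div, neg_neg]

theorem hasDerivAt_comp_horizontal {f : ℂ → ℂ} {σ t : ℝ}
    (hf : DifferentiableAt ℂ f ((σ : ℂ) + t * I)) :
    HasDerivAt (fun σ : ℝ => f ((σ : ℂ) + t * I)) (deriv f ((σ : ℂ) + t * I)) σ :=
  (hf.hasDerivAt.comp_add_const (σ : ℂ) (t * I)).comp_ofReal

theorem ne_one_of_im_ne_zero {σ t : ℝ} (ht : t ≠ 0) : (σ : ℂ) + t * I ≠ 1 := fun h =>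
  ht (by simpa using congrArg im h)

/-- The smoothed Dirichlet polynomial approximating `log ζ`. -/
noncomputable def logZetaPoly (x t σ : ℝ) : ℂ :=
  ∑ n ∈ Finset.Icc 2 ⌊x⌋₊, ((ArithmeticFunction.vonMangoldt n : ℝ) : ℂ) /
    ((n : ℂ) ^ ((σ : ℂ) + (t : ℂ) * I) * ((Real.log (n : ℝ) : ℝ) : ℂ)) *
      ((Real.log (x / (n : ℝ)) / Real.log x : ℝ) : ℂ)

/-- Minus the derivative of `logZetaPoly` in the real part. -/
noncomputable def zetaPoly (x t σ : ℝ) : ℂ :=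
  ∑ n ∈ Finset.Icc 2 ⌊x⌋₊, ((ArithmeticFunction.vonMangoldt n : ℝ) : ℂ) *
    (n : ℂ) ^ (-((σ : ℂ) + (t : ℂ) * I)) * ((Real.log (x / (n : ℝ)) / Real.log x : ℝ) : ℂ)

theorem hasDerivAt_logZetaPoly (x t σ : ℝ) :
    HasDerivAt (logZetaPoly x t) (-zetaPoly x t σ) σ := by
  unfold logZetaPoly zetaPoly
  rw [← Finset.sum_neg_distrib]
  refine HasDerivAt.fun_sum fun n hn => ?_
  have hn2 : 2 ≤ n := (Finset.mem_Icc.1 hn).1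
  have hn0 : (n : ℂ) ≠ 0 := Nat.cast_ne_zero.2 (by omega)
  have hlog : ((Real.log (n : ℝ) : ℝ) : ℂ) ≠ 0 := by
    rw [ofReal_ne_zero]
    exact (Real.log_pos (by exact_mod_cast hn2)).ne'
  have h1 : HasDerivAt (fun s : ℂ => (n : ℂ) ^ (-s))
      ((n : ℂ) ^ (-((σ : ℂ) + t * I)) * Complex.log n * (-1)) ((σ : ℂ) + t * I) :=
    (hasDerivAt_neg _).const_cpow (Or.inl hn0)
  have h2 := (h1.comp_add_const (σ : ℂ) (t * I)).comp_ofReal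
  have h3 := (h2.const_mul (((ArithmeticFunction.vonMangoldt n : ℝ) : ℂ) /
    ((Real.log (n : ℝ) : ℝ) : ℂ))).mul_const ((Real.log (x / (n : ℝ)) / Real.log x : ℝ) : ℂ)
  refine (h3.congr_deriv ?_).congr_of_eventuallyEq (Eventually.of_forall fun y => ?_)
  · rw [← natCast_log]
    field_simp
  · simp only [cpow_neg]
    have : (n : ℂ) ^ ((y : ℂ) + t * I) ≠ 0 := by simp [cpow_eq_zero_iff, hn0]
    field_simp

theorem tendsto_logZetaPoly (x t : ℝ) : Tendsto (logZetaPoly x t) atTop (𝓝 0) := by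
  unfold logZetaPoly
  rw [show (0 : ℂ) = ∑ n ∈ Finset.Icc 2 ⌊x⌋₊, 0 by simp]
  refine tendsto_finsetSum _ fun n hn => ?_
  have hn2 : 2 ≤ n := (Finset.mem_Icc.1 hn).1
  have hn1 : (1 : ℝ) < n := by exact_mod_cast hn2
  rw [tendsto_zero_iff_norm_tendsto_zero]
  have h1 := ((tendsto_rpow_atTop_of_base_gt_one _ hn1).const_div_atTop
    (‖((ArithmeticFunction.vonMangoldt n : ℝ) : ℂ)‖ / ‖((Real.log (n : ℝ) : ℝ) : ℂ)‖)).mul_const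
    ‖((Real.log (x / (n : ℝ)) / Real.log x : ℝ) : ℂ)‖
  rw [zero_mul] at h1
  refine h1.congr fun σ => ?_
  rw [norm_mul, norm_div, norm_mul, norm_natCast_cpow_of_pos (by omega)]
  simp only [add_re, ofReal_re, mul_re, I_re, mul_zero, ofReal_im, I_im, mul_one, sub_self,
    add_zero]
  rw [div_div, mul_comm ((n : ℝ) ^ σ)]

theorem zetaPoly_eq {x : ℝ} (hx : 1 < x) (t σ : ℝ) :
    ∑ n ∈ Finset.Icc 1 ⌊Real.exp (Real.log x)⌋₊, (ArithmeticFunction.vonMangoldt n : ℂ) *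
      (n : ℂ) ^ (-((σ : ℂ) + t * I)) * ((Real.log x - Real.log n : ℝ) : ℂ) =
      Real.log x * zetaPoly x t σ := by
  have hx0 : 0 < x := by linarith
  have hlog : (Real.log x : ℂ) ≠ 0 := ofReal_ne_zero.2 (Real.log_pos hx).ne'
  rw [Real.exp_log hx0]
  have h1 : 1 ≤ ⌊x⌋₊ := Nat.le_floor (by simpa using hx.le)
  rw [← Finset.insert_Icc_add_one_left_eq_Icc h1, Finset.sum_insert (by simp), zetaPoly,
    Finset.mul_sum]
  simp only [ArithmeticFunction.vonMangoldt_apply_one, ofReal_zero, zero_mul, zero_add]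
  refine Finset.sum_congr rfl fun n hn => ?_
  have hn2 : 2 ≤ n := (Finset.mem_Icc.1 hn).1
  have hn0 : (n : ℝ) ≠ 0 := Nat.cast_ne_zero.2 (by omega)
  rw [Real.log_div hx0.ne' hn0]
  push_cast
  field_simp

theorem norm_zetaPoly_le {x : ℝ} (hx : 1 < x) (t : ℝ) {σ : ℝ} (hσ : 2 ≤ σ) :
    ‖zetaPoly x t σ‖ ≤ ∑' n : ℕ, ArithmeticFunction.vonMangoldt n / (n : ℝ) ^ 2 := by
  have hsum : Summable fun n : ℕ => ArithmeticFunction.vonMangoldt n / (n : ℝ) ^ 2 := by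
    have h := (ArithmeticFunction.LSeriesSummable_vonMangoldt (s := 2) (by norm_num)).norm
    refine h.congr fun n => ?_
    rcases eq_or_ne n 0 with rfl | hn
    · simp
    · rw [LSeries.norm_term_eq, if_neg hn, norm_real,
        Real.norm_of_nonneg ArithmeticFunction.vonMangoldt_nonneg]
      simp
  unfold zetaPoly
  refine (norm_sum_le _ _).trans (le_trans (Finset.sum_le_sum fun n hn => ?_)
    (hsum.sum_le_tsum (Finset.Icc 2 ⌊x⌋₊) fun n _ =>
      div_nonneg ArithmeticFunction.vonMangoldt_nonneg (by positivity)))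
  obtain ⟨hn2, hnx⟩ := Finset.mem_Icc.1 hn
  have hn1 : (1 : ℝ) ≤ n := by exact_mod_cast (by omega : 1 ≤ n)
  have hnx' : (n : ℝ) ≤ x := (Nat.le_floor_iff (by linarith)).1 hnx
  have hlog := Real.log_pos hx
  have h1 : Real.log (x / n) / Real.log x ≤ 1 := by
    rw [div_le_one hlog]
    exact Real.log_le_log (by positivity) (div_le_self (by linarith) hn1)
  have h2 : 0 ≤ Real.log (x / n) / Real.log x :=
    div_nonneg (Real.log_nonneg ((one_le_div (by linarith)).2 hnx')) hlog.le
  have h3 : (n : ℝ) ^ (-σ) ≤ ((n : ℝ) ^ 2)⁻¹ := by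
    rw [← Real.rpow_natCast, ← Real.rpow_neg (by linarith)]
    exact Real.rpow_le_rpow_of_exponent_le hn1 (by push_cast; linarith)
  rw [norm_mul, norm_mul, norm_real, norm_real, Real.norm_of_nonneg h2,
    Real.norm_of_nonneg ArithmeticFunction.vonMangoldt_nonneg,
    norm_natCast_cpow_of_pos (by omega)]
  have h4 : (-((σ : ℂ) + t * I)).re = -σ := by simp
  rw [h4, div_eq_mul_inv]
  calc _ ≤ ArithmeticFunction.vonMangoldt n * ((n : ℝ) ^ 2)⁻¹ * 1 :=
        mul_le_mul (mul_le_mul_of_nonneg_left h3 ArithmeticFunction.vonMangoldt_nonneg) h1 h2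
          (mul_nonneg ArithmeticFunction.vonMangoldt_nonneg (by positivity))
    _ = _ := mul_one _

/-- To the right of 2 the derivative of the polynomial is at most Σ Λ(n)/n², uniformly in x and t.
This serves the range of large λ. -/
theorem re_logZetaPoly_two_le {x : ℝ} (hx : 1 < x) (t : ℝ) {σ : ℝ} (hσ : 2 ≤ σ) :
    (logZetaPoly x t 2).re ≤ (logZetaPoly x t σ).re +
      (∑' n : ℕ, ArithmeticFunction.vonMangoldt n / (n : ℝ) ^ 2) * (σ - 2) := by
  set K := ∑' n : ℕ, ArithmeticFunction.vonMangoldt n / (n : ℝ) ^ 2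
  have hder : ∀ y : ℝ, HasDerivAt (fun y : ℝ => (logZetaPoly x t y).re + K * y)
      ((-zetaPoly x t y).re + K * 1) y := fun y =>
    (hasDerivAt_logZetaPoly x t y).re_comp.add ((hasDerivAt_id y).const_mul K)
  have hmono : MonotoneOn (fun y : ℝ => (logZetaPoly x t y).re + K * y) (Ici 2) := by
    refine monotoneOn_of_deriv_nonneg (convex_Ici 2)
      (fun y _ => (hder y).continuousAt.continuousWithinAt)
      (fun y _ => (hder y).differentiableAt.differentiableWithinAt) fun y hy => ?_
    rw [(hder y).deriv]
    rw [interior_Ici] at hy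
    have h1 := (re_le_norm (zetaPoly x t y)).trans (norm_zetaPoly_le hx t (le_of_lt hy))
    rw [neg_re]
    linarith
  have := hmono self_mem_Ici (show σ ∈ Ici 2 from hσ) hσ
  simp only at this
  linarith

namespace RiemannHypothesis

theorem hasDerivAt_log_norm_riemannZeta (hRH : RiemannHypothesis) {σ t : ℝ} (hσ : 1 / 2 < σ)
    (ht : t ≠ 0) : HasDerivAt (fun σ : ℝ => Real.log ‖riemannZeta ((σ : ℂ) + t * I)‖)
      (logDeriv riemannZeta ((σ : ℂ) + t * I)).re σ :=
  (hasDerivAt_comp_horizontal (differentiableAt_riemannZeta (ne_one_of_im_ne_zero ht))).log_norm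
    (hRH.riemannZeta_ne_zero (by simpa using hσ))

/-- Each summand m/((σ - 1/2)² + (t - γ)²) decreases in σ. -/
theorem re_logDeriv_riemannXi_div_antitone (hRH : RiemannHypothesis) (t : ℝ) {σ σ' : ℝ}
    (hσ : 1 / 2 < σ) (hσσ' : σ ≤ σ') :
    (logDeriv riemannXi ((σ' : ℂ) + t * I)).re / (σ' - 1 / 2) ≤
      (logDeriv riemannXi ((σ : ℂ) + t * I)).re / (σ - 1 / 2) := by
  have h1 := hRH.hasSum_zeros (s := (σ : ℂ) + t * I) (by simpa using hσ)
  have h2 := hRH.hasSum_zeros (s := (σ' : ℂ) + t * I) (by simpa using hσ.trans_le hσσ')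
  have e : ∀ y : ℝ, ((y : ℂ) + t * I).re = y := fun y => by simp
  rw [e] at h1 h2
  refine hasSum_le (fun ρ => ?_) h2 h1
  have hρ := hRH.re_coe_eq ρ
  have h3 : ∀ y : ℝ, ‖(y : ℂ) + t * I - ρ‖ ^ 2 = (y - 1 / 2) ^ 2 + (t - (ρ : ℂ).im) ^ 2 := by
    intro y
    rw [Complex.sq_norm, normSq_apply, sub_re, hρ, e]
    simp
    ring
  rw [h3, h3]
  have h4 : 0 < (σ - 1 / 2) ^ 2 := pow_pos (by linarith) 2
  have h5 : (σ - 1 / 2) ^ 2 ≤ (σ' - 1 / 2) ^ 2 := pow_le_pow_left₀ (by linarith) (by linarith) 2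
  gcongr

theorem re_logDeriv_riemannXi_nonneg (hRH : RiemannHypothesis) (t : ℝ) {σ : ℝ} (hσ : 1 / 2 < σ) :
    0 ≤ (logDeriv riemannXi ((σ : ℂ) + t * I)).re := by
  have h1 := (hRH.hasSum_zeros (s := (σ : ℂ) + t * I) (by simpa using hσ)).nonneg
    fun ρ => by positivity
  have e : ((σ : ℂ) + t * I).re = σ := by simp
  rw [e] at h1
  have h2 : 0 < σ - 1 / 2 := by linarith
  have := mul_nonneg h1 h2.le
  rwa [div_mul_cancel₀ _ h2.ne'] at this

/-- Stirling without an error term: (log π)/2 ≥ 1/2 outweighs π²/24 ≤ 0.42 and the small losses from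
1/(s - 1) and from log|s/2 + 1| ≤ log T + 1/100. -/
theorem re_logDeriv_riemannXi_sub_le (hRH : RiemannHypothesis) {T t σ : ℝ} (hT : 100 ≤ T)
    (ht : T ≤ t) (ht' : t ≤ 2 * T) (hσ : 1 / 2 < σ) (hσ' : σ ≤ 2) :
    (logDeriv riemannXi ((σ : ℂ) + t * I)).re - 1 / 2 * Real.log T ≤
      (logDeriv riemannZeta ((σ : ℂ) + t * I)).re := by
  set s : ℂ := (σ : ℂ) + t * I with hs
  have hre : s.re = σ := by simp [hs]
  have him : s.im = t := by simp [hs]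
  have hs1 : s ≠ 1 := ne_one_of_im_ne_zero (by linarith)
  rw [logDeriv_riemannZeta_eq (by rw [hre]; linarith) hs1
    (hRH.riemannZeta_ne_zero (by rw [hre]; exact hσ))]
  have h1 : (1 / (s - 1)).re ≤ 1 / 100 := by
    refine (re_le_norm _).trans ?_
    rw [norm_div, norm_one]
    refine one_div_le_one_div_of_le (by norm_num) ?_
    refine le_trans ?_ ((le_abs_self _).trans (abs_im_le_norm _))
    rw [sub_im, him, one_im]
    linarith
  have hz : (s / 2 + 1).re = σ / 2 + 1 := by simp [hre]
  have hzi : (s / 2 + 1).im = t / 2 := by simp [him]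
  have h2 := re_digamma_le (z := s / 2 + 1) (by rw [hz]; linarith)
  have hT0 : 0 < T := by linarith
  have h3 : Real.log ‖s / 2 + 1‖ ≤ Real.log T + 1 / 100 := by
    have h4 : ‖s / 2 + 1‖ ^ 2 ≤ T ^ 2 * (1 + 1 / 50) := by
      rw [Complex.sq_norm, normSq_apply, hz, hzi]
      nlinarith
    have hpos : 0 < ‖s / 2 + 1‖ := norm_pos_iff.2 fun h => by
      have := congrArg re h
      rw [hz] at this
      simp at this
      linarith
    have h5 := Real.log_le_log (pow_pos hpos 2) h4
    rw [Real.log_pow, Real.log_mul (by positivity) (by norm_num), Real.log_pow] at h5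
    have h6 := Real.log_le_sub_one_of_pos (show (0 : ℝ) < 1 + 1 / 50 by norm_num)
    push_cast at h5
    linarith
  have h7 : 1 ≤ Real.log Real.pi := by
    rw [Real.le_log_iff_exp_le Real.pi_pos]
    have := Real.exp_one_lt_d9
    have := Real.pi_gt_three
    linarith
  have h8 : Real.pi ^ 2 / 12 ≤ 0.84 := by
    have := Real.pi_lt_d2
    nlinarith [Real.pi_pos]
  have h9 : ((Real.log Real.pi : ℂ) / 2).re = Real.log Real.pi / 2 := by
    rw [show (Real.log Real.pi : ℂ) / 2 = ((Real.log Real.pi / 2 : ℝ) : ℂ) by push_cast; rfl,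
      ofReal_re]
  have h10 : (digamma (s / 2 + 1) / 2).re = (digamma (s / 2 + 1)).re / 2 := by simp
  rw [sub_re, add_re, sub_re, h9, h10]
  linarith

theorem log_norm_riemannZeta_half_le (hRH : RiemannHypothesis) {T t σ : ℝ} (hT : 100 ≤ T)
    (ht : T ≤ t) (ht' : t ≤ 2 * T) (hσ : 1 / 2 < σ) (hσ' : σ ≤ 2)
    (h0 : riemannZeta (((1 / 2 : ℝ) : ℂ) + t * I) ≠ 0) :
    Real.log ‖riemannZeta (((1 / 2 : ℝ) : ℂ) + t * I)‖ ≤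
      Real.log ‖riemannZeta ((σ : ℂ) + t * I)‖ + (σ - 1 / 2) / 2 * Real.log T -
        (σ - 1 / 2) / 2 * (logDeriv riemannXi ((σ : ℂ) + t * I)).re := by
  have ht0 : t ≠ 0 := by linarith
  set A := (logDeriv riemannXi ((σ : ℂ) + t * I)).re / (σ - 1 / 2) with hA
  have hder : ∀ y : ℝ, 1 / 2 < y → HasDerivAt (fun y : ℝ =>
      Real.log ‖riemannZeta ((y : ℂ) + t * I)‖ + (y - 1 / 2) / 2 * Real.log T -
        A * ((y - 1 / 2) ^ 2 / 2))
      ((logDeriv riemannZeta ((y : ℂ) + t * I)).re + 1 / 2 * Real.log T - A * (y - 1 / 2)) y := by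
    intro y hy
    have h1 : HasDerivAt (fun y : ℝ => y - 1 / 2) 1 y := (hasDerivAt_id y).sub_const _
    refine (((hRH.hasDerivAt_log_norm_riemannZeta hy ht0).add
      ((h1.div_const 2).mul_const (Real.log T))).sub
      (((h1.pow 2).div_const 2).const_mul A)).congr_deriv ?_
    simp
  have hcont : ContinuousOn (fun y : ℝ =>
      Real.log ‖riemannZeta ((y : ℂ) + t * I)‖ + (y - 1 / 2) / 2 * Real.log T -
        A * ((y - 1 / 2) ^ 2 / 2)) (Icc (1 / 2) σ) := by
    intro y hy
    refine ContinuousAt.continuousWithinAt ?_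
    -- Only the endpoint 1/2 uses that ζ does not vanish there; to its right RH ensures it.
    rcases hy.1.eq_or_lt with h | h
    · subst h
      have h1 := (hasDerivAt_comp_horizontal (differentiableAt_riemannZeta
        (ne_one_of_im_ne_zero (σ := 1 / 2) ht0))).log_norm h0
      exact (h1.continuousAt.add (by fun_prop)).sub (by fun_prop)
    · exact (hder y h).continuousAt
  have hmono := monotoneOn_of_deriv_nonneg (convex_Icc (1 / 2) σ) hcont
    (fun y hy => by
      rw [interior_Icc] at hy
      exact (hder y hy.1).differentiableAt.differentiableWithinAt)
    (fun y hy => by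
      rw [interior_Icc] at hy
      rw [(hder y hy.1).deriv]
      have h1 := hRH.re_logDeriv_riemannXi_sub_le hT ht ht' hy.1 (hy.2.le.trans hσ')
      have h2 := hRH.re_logDeriv_riemannXi_div_antitone t hy.1 hy.2.le
      rw [le_div_iff₀ (by linarith [hy.1])] at h2
      linarith)
  have h := hmono (left_mem_Icc.2 hσ.le) (right_mem_Icc.2 hσ.le) hσ.le
  have hA' : A * ((σ - 1 / 2) ^ 2 / 2) =
      (σ - 1 / 2) / 2 * (logDeriv riemannXi ((σ : ℂ) + t * I)).re := by
    have : σ - 1 / 2 ≠ 0 := by linarith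
    rw [hA, pow_two]
    field_simp
  simp only [sub_self] at h
  rw [hA'] at h
  linarith

/-- The auxiliary function H below has derivative 1/log x times the explicit-formula expression plus
its error bound, hence is nondecreasing. It tends to 0 at infinity, so H(σ) ≤ 0. Monotonicity of
F/(σ - 1/2) lets B be frozen at σ. -/
theorem log_norm_riemannZeta_le (hRH : RiemannHypothesis) {x t σ : ℝ} (hx : 1 < x)
    (hxt : Real.exp (Real.log x / 2) ≤ t ^ 2) (hσ : 1 / 2 < σ) :
    Real.log ‖riemannZeta ((σ : ℂ) + t * I)‖ ≤ (logZetaPoly x t σ).re -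
      (logDeriv riemannZeta ((σ : ℂ) + t * I)).re / Real.log x +
      ((logDeriv riemannXi ((σ : ℂ) + t * I)).re / (σ - 1 / 2) + 2) / Real.log x ^ 2 *
        Real.exp (-Real.log x * (σ - 1 / 2)) := by
  set v := Real.log x with hv
  have hv0 : 0 < v := Real.log_pos hx
  have ht0 : t ≠ 0 := by
    rintro rfl
    have := Real.exp_pos (v / 2)
    norm_num at hxt
    linarith
  set B := (logDeriv riemannXi ((σ : ℂ) + t * I)).re / (σ - 1 / 2) + 2 with hB
  set H : ℝ → ℝ := fun y => Real.log ‖riemannZeta ((y : ℂ) + t * I)‖ - (logZetaPoly x t y).re +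
    (logDeriv riemannZeta ((y : ℂ) + t * I)).re / v -
    B / v ^ 2 * Real.exp (-v * (y - 1 / 2)) with hH
  have hder : ∀ y : ℝ, 1 / 2 < y → HasDerivAt H
      ((logDeriv riemannZeta ((y : ℂ) + t * I)).re - (-zetaPoly x t y).re +
        (deriv (logDeriv riemannZeta) ((y : ℂ) + t * I)).re / v -
        B / v ^ 2 * (Real.exp (-v * (y - 1 / 2)) * (-v * 1))) y := by
    intro y hy
    have hs1 : (y : ℂ) + t * I ≠ 1 := ne_one_of_im_ne_zero ht0
    have hD : DifferentiableAt ℂ (logDeriv riemannZeta) ((y : ℂ) + t * I) := by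
      have h1 : AnalyticAt ℂ riemannZeta ((y : ℂ) + t * I) := analyticOn_riemannZeta _ hs1
      exact h1.deriv.differentiableAt.div h1.differentiableAt
        (hRH.riemannZeta_ne_zero (by simpa using hy))
    have h1 : HasDerivAt (fun y : ℝ => y - 1 / 2) 1 y := (hasDerivAt_id y).sub_const _
    exact (((hRH.hasDerivAt_log_norm_riemannZeta hy ht0).sub (hasDerivAt_logZetaPoly x t y).re_comp).add
      ((hasDerivAt_comp_horizontal hD).re_comp.div_const v)).sub
      (((h1.const_mul (-v)).exp).const_mul (B / v ^ 2))
  have hnn : ∀ y : ℝ, σ ≤ y → 0 ≤ (logDeriv riemannZeta ((y : ℂ) + t * I)).re -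
      (-zetaPoly x t y).re + (deriv (logDeriv riemannZeta) ((y : ℂ) + t * I)).re / v -
        B / v ^ 2 * (Real.exp (-v * (y - 1 / 2)) * (-v * 1)) := by
    intro y hy
    have hy2 : 1 / 2 < y := hσ.trans_le hy
    have hre : ((y : ℂ) + t * I).re = y := by simp
    have him : ((y : ℂ) + t * I).im = t := by simp
    have h1 := hRH.norm_explicit_formula_le (s := (y : ℂ) + t * I) (by rw [hre]; exact hy2) hv0
      (by rw [him]; exact hxt)
    rw [hv, zetaPoly_eq hx, ← hv, hre] at h1
    have h2 := hRH.re_logDeriv_riemannXi_div_antitone t hσ hy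
    have h3 := (neg_le_abs _).trans ((abs_re_le_norm _).trans h1)
    rw [add_re, add_re, re_ofReal_mul, re_mul_ofReal] at h3
    have h4 : ((logDeriv riemannXi ((y : ℂ) + t * I)).re / (y - 1 / 2) + 2) *
        Real.exp (-v * (y - 1 / 2)) ≤ B * Real.exp (-v * (y - 1 / 2)) := by
      refine mul_le_mul_of_nonneg_right ?_ (Real.exp_pos _).le
      linarith
    have h5 : (logDeriv riemannZeta ((y : ℂ) + t * I)).re - (-zetaPoly x t y).re +
        (deriv (logDeriv riemannZeta) ((y : ℂ) + t * I)).re / v -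
        B / v ^ 2 * (Real.exp (-v * (y - 1 / 2)) * (-v * 1)) =
        (v * (zetaPoly x t y).re + (logDeriv riemannZeta ((y : ℂ) + t * I)).re * v +
          (deriv (logDeriv riemannZeta) ((y : ℂ) + t * I)).re +
          B * Real.exp (-v * (y - 1 / 2))) / v := by
      rw [neg_re]
      field_simp
      ring
    rw [h5]
    exact div_nonneg (by linarith) hv0.le
  have hmono : MonotoneOn H (Ici σ) := by
    refine monotoneOn_of_deriv_nonneg (convex_Ici σ)
      (fun y hy => (hder y (hσ.trans_le hy)).continuousAt.continuousWithinAt)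
      (fun y hy => ?_) fun y hy => ?_
    · rw [interior_Ici] at hy
      exact (hder y (hσ.trans hy)).differentiableAt.differentiableWithinAt
    · rw [interior_Ici] at hy
      rw [(hder y (hσ.trans hy)).deriv]
      exact hnn y (le_of_lt hy)
  have hlim : Tendsto H atTop (𝓝 (Real.log ‖(1 : ℂ)‖ - (0 : ℂ).re + (0 : ℂ).re / v -
      B / v ^ 2 * 0)) := by
    refine ((Tendsto.sub ?_ ?_).add ?_).sub (Tendsto.const_mul _ ?_)
    · exact ((tendsto_riemannZeta_horizontal t).norm).log (by simp)
    · exact (continuous_re.tendsto _).comp (tendsto_logZetaPoly x t)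
    · exact ((continuous_re.tendsto _).comp (tendsto_logDeriv_riemannZeta_horizontal t)).div_const v
    · refine Real.tendsto_exp_atBot.comp ?_
      refine Tendsto.const_mul_atTop_of_neg (by linarith) ?_
      exact tendsto_atTop_add_const_right _ _ tendsto_id
  simp only [norm_one, Real.log_one, zero_re, zero_div, mul_zero, sub_zero, add_zero] at hlim
  have hle : H σ ≤ 0 := by
    refine ge_of_tendsto hlim ?_
    filter_upwards [eventually_ge_atTop σ] with y hy
    exact hmono self_mem_Ici (show y ∈ Ici σ from hy) hy
  simp only [hH] at hle
  linarith

theorem log_norm_riemannZeta_half_le_of_le (hRH : RiemannHypothesis) {T t x lam : ℝ}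
    (hT : 100 ≤ T) (ht : T ≤ t) (ht' : t ≤ 2 * T) (hx : 2 ≤ x) (hxT : x ≤ T ^ 2)
    (hlam0 : 0 < lam) (hlam : Real.exp (-lam) ≤ lam + lam ^ 2 / 2)
    (hlam' : lam / Real.log x ≤ 3 / 2)
    (h0 : riemannZeta (((1 / 2 : ℝ) : ℂ) + t * I) ≠ 0) :
    Real.log ‖riemannZeta (((1 / 2 : ℝ) : ℂ) + t * I)‖ ≤
      (logZetaPoly x t (1 / 2 + lam / Real.log x)).re +
        (1 + lam) / 2 * (Real.log T / Real.log x) + 2 / Real.log 2 / Real.log x := by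
  have hx1 : 1 < x := by linarith
  set v := Real.log x with hv
  have hv0 : 0 < v := Real.log_pos hx1
  have hv2 : Real.log 2 ≤ v := Real.log_le_log (by norm_num) hx
  have hl2 : 0 < Real.log 2 := Real.log_pos (by norm_num)
  have hσ : 1 / 2 < 1 / 2 + lam / v := by
    have : 0 < lam / v := div_pos hlam0 hv0
    linarith
  have hxt : Real.exp (v / 2) ≤ t ^ 2 := by
    have h1 : v ≤ 2 * Real.log T := by
      have := Real.log_le_log (by linarith) hxT
      rwa [Real.log_pow] at this
    have h2 : Real.exp (v / 2) ≤ T := by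
      rw [← Real.le_log_iff_exp_le (by linarith)]
      linarith
    nlinarith
  have hA := hRH.log_norm_riemannZeta_half_le hT ht ht' hσ (by linarith) h0
  have hB := hRH.log_norm_riemannZeta_le hx1 hxt hσ
  have hC := hRH.re_logDeriv_riemannXi_sub_le hT ht ht' hσ (by linarith)
  have hF := hRH.re_logDeriv_riemannXi_nonneg t hσ
  rw [← hv] at hB
  set F := (logDeriv riemannXi (((1 / 2 + lam / v : ℝ) : ℂ) + t * I)).re
  set D := (logDeriv riemannZeta (((1 / 2 + lam / v : ℝ) : ℂ) + t * I)).re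
  set Z := Real.log ‖riemannZeta (((1 / 2 + lam / v : ℝ) : ℂ) + t * I)‖
  have e1 : 1 / 2 + lam / v - 1 / 2 = lam / v := by ring
  have e2 : -v * (lam / v) = -lam := by field_simp
  rw [e1] at hA hB
  rw [e2] at hB
  -- The condition on λ enters only here, as e^{-λ}/λ ≤ 1 + λ/2. The summand 2 leaves 2e^{-λ}/v² ≤
  -- (2/log 2)/v, which is the source of C.
  have h1 : (F / (lam / v) + 2) / v ^ 2 * Real.exp (-lam) ≤
      F * (1 + lam / 2) / v + 2 / Real.log 2 / v := by
    have h2 : (F / (lam / v) + 2) / v ^ 2 * Real.exp (-lam) =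
        F * (Real.exp (-lam) / lam) / v + 2 * Real.exp (-lam) / v / v := by
      field_simp
    rw [h2]
    have h3 : Real.exp (-lam) / lam ≤ 1 + lam / 2 := by
      rw [div_le_iff₀ hlam0]
      linarith
    have h4 : Real.exp (-lam) ≤ 1 := Real.exp_le_one_iff.2 (by linarith)
    have h5 : 2 * Real.exp (-lam) / v ≤ 2 / Real.log 2 := by
      gcongr
      linarith
    gcongr
  have h2 : -(D / v) ≤ (1 / 2 * Real.log T - F) / v := by
    rw [← neg_div]
    gcongr
    linarith
  -- All terms in F cancel, leaving the coefficient (1 + λ)/2.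
  have h3 : lam / v / 2 * Real.log T + (1 / 2 * Real.log T - F) / v - lam / v / 2 * F +
      F * (1 + lam / 2) / v = (1 + lam) / 2 * (Real.log T / v) := by
    field_simp
    ring
  linarith

theorem exists_log_norm_riemannZeta_half_le (hRH : RiemannHypothesis) {lam₀ : ℝ}
    (hlam0 : 0 < lam₀) (hlam1 : lam₀ < 1)
    (hlam : ∀ y : ℝ, lam₀ ≤ y → Real.exp (-y) ≤ y + y ^ 2 / 2) :
    ∃ C T₀ : ℝ, ∀ T : ℝ, T₀ ≤ T → ∀ t ∈ Set.Icc T (2 * T), ∀ x ∈ Set.Icc (2 : ℝ) (T ^ 2),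
      ∀ lam : ℝ, lam₀ ≤ lam → riemannZeta (((1 / 2 : ℝ) : ℂ) + t * I) ≠ 0 →
        Real.log ‖riemannZeta (((1 / 2 : ℝ) : ℂ) + t * I)‖ ≤
          (logZetaPoly x t (1 / 2 + lam / Real.log x)).re +
            (1 + lam) / 2 * (Real.log T / Real.log x) + C / Real.log x := by
  set K := ∑' n : ℕ, ArithmeticFunction.vonMangoldt n / (n : ℝ) ^ 2 with hK
  -- T ≥ e^{2K} makes the gain (1/2) log T per unit of σ at least the loss K.
  refine ⟨2 / Real.log 2, max 100 (Real.exp (2 * K)), fun T hT t ht x hx lam hl h0 => ?_⟩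
  have hT1 : 100 ≤ T := (le_max_left _ _).trans hT
  have hT2 : 2 * K ≤ Real.log T := by
    rw [Real.le_log_iff_exp_le (by linarith)]
    exact (le_max_right _ _).trans hT
  have hx1 : 1 < x := by linarith [hx.1]
  have hv0 : 0 < Real.log x := Real.log_pos hx1
  rcases le_or_gt (lam / Real.log x) (3 / 2) with h | h
  · exact hRH.log_norm_riemannZeta_half_le_of_le hT1 ht.1 ht.2 hx.1 hx.2 (hlam0.trans_le hl)
      (hlam lam hl) h h0
  -- Here σ exceeds 2, so the bound is taken with λ = (3/2) log x, i.e. at σ = 2. This is admissible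
  -- since λ₀ < 1 < (3/2) log 2.
  · have hl2 : lam₀ ≤ 3 / 2 * Real.log x := by
      have h1 := Real.log_two_gt_d9
      have h2 := Real.log_le_log (by norm_num) hx.1
      linarith
    have h1 := hRH.log_norm_riemannZeta_half_le_of_le hT1 ht.1 ht.2 hx.1 hx.2
      (hlam0.trans_le hl2) (hlam _ hl2) (by rw [mul_div_cancel_right₀ _ hv0.ne']) h0
    rw [mul_div_cancel_right₀ _ hv0.ne', show (1 / 2 : ℝ) + 3 / 2 = 2 by norm_num] at h1
    have h2 := re_logZetaPoly_two_le hx1 t (σ := 1 / 2 + lam / Real.log x) (by linarith)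
    rw [← hK] at h2
    have h3 : K * (1 / 2 + lam / Real.log x - 2) ≤
        1 / 2 * Real.log T * (lam / Real.log x - 3 / 2) := by
      have h4 : 1 / 2 + lam / Real.log x - 2 = lam / Real.log x - 3 / 2 := by ring
      rw [h4]
      exact mul_le_mul_of_nonneg_right (by linarith) (by linarith)
    have h4 : (1 + 3 / 2 * Real.log x) / 2 * (Real.log T / Real.log x) +
        1 / 2 * Real.log T * (lam / Real.log x - 3 / 2) =
        (1 + lam) / 2 * (Real.log T / Real.log x) := by
      field_simp
      ring
    linarith

end RiemannHypothesis

end Main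

theorem mainTheorem2 :
    ∃ lam₀ : ℝ,
      (0 < lam₀ ∧ Real.exp (-lam₀) = lam₀ + lam₀ ^ 2 / 2) ∧
      (∀ y : ℝ, 0 < y → Real.exp (-y) = y + y ^ 2 / 2 → y = lam₀) ∧
      (0.4912 < lam₀ ∧ lam₀ < 0.4913) ∧
      (RiemannHypothesis →
        ∃ C T₀ : ℝ, ∀ T : ℝ, T₀ ≤ T → ∀ t ∈ Set.Icc T (2 * T), ∀ x ∈ Set.Icc (2 : ℝ) (T ^ 2),
          ∀ lam : ℝ, lam₀ ≤ lam →
            ENNReal.log ‖riemannZeta (1 / 2 + (t : ℂ) * Complex.I)‖ₑ ≤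
              (((∑ n ∈ Finset.Icc 2 ⌊x⌋₊,
                  ((ArithmeticFunction.vonMangoldt n : ℝ) : ℂ) /
                      ((n : ℂ) ^ (((1 / 2 + lam / Real.log x : ℝ) : ℂ) + (t : ℂ) * Complex.I) *
                        ((Real.log (n : ℝ) : ℝ) : ℂ)) *
                    ((Real.log (x / (n : ℝ)) / Real.log x : ℝ) : ℂ)).re
                + (1 + lam) / 2 * (Real.log T / Real.log x)
                + C / Real.log x : ℝ) : EReal)) := by
  obtain ⟨l, h1, h2, h3, h4⟩ := exists_unique_exp_neg_eq_quadratic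
  refine ⟨l, h1, h2, h3, fun hRH => ?_⟩
  obtain ⟨C, T₀, h⟩ := hRH.exists_log_norm_riemannZeta_half_le h1.1 (by linarith [h3.2]) h4
  refine ⟨C, T₀, fun T hT t ht x hx lam hl => ?_⟩
  have hhalf : (1 / 2 : ℂ) = ((1 / 2 : ℝ) : ℂ) := by push_cast; rfl
  rw [hhalf]
  -- At a zero of ζ the left side is ⊥ in `EReal`, and nothing is to be proved.
  by_cases hz : riemannZeta (((1 / 2 : ℝ) : ℂ) + (t : ℂ) * Complex.I) = 0
  · rw [hz, enorm_zero, ENNReal.log_zero]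
    exact bot_le
  · rw [← ofReal_norm, ENNReal.log_ofReal_of_pos (norm_pos_iff.2 hz), EReal.coe_le_coe_iff]
    exact h T hT t ht x hx lam hl hz
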